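/- **Setting.** Let $\mathcal X$ be a measurable space and $\mathcal H\subset\{0,1\}^{\mathcal X}$ a nonempty class of binary functions such that for all $n$ and all $y_1,\dots,y_n\in[0,1]$ the function $(x_1,\dots,x_n)\mapsto\inf_{h\in\mathcal H}\sum_{i=1}^n|h(x_i)-y_i|$ is measurable on $\mathcal X^n$. A prediction rule $\Phi$ assigns to every $t\ge 1$, all $x^t=(x_1,\dots,x_t)\in\mathcal X^t$ and all $y^{t-1}=(y_1,\dots,y_{t-1})\in[0,1]^{t-1}$ a probability distribution $\Phi(x^t,y^{t-1})$ on $[0,1]$. Its hybrid minimax regret under the absolute loss at horizon $T$ is $$\tilde r_T(\mathcal H,\Phi)=\sup_{\mu}\mathbb E_{x_1}\sup_{y_1\in[0,1]}\mathbb E_{\hat y_1}\cdots\mathbb E_{x_T}\sup_{y_T\in[0,1]}\mathbb E_{\hat y_T}\Big[\sum_{t=1}^T|\hat y_t-y_t|-\inf_{h\in\mathcal H}\sum_{t=1}^T|h(x_t)-y_t|\Big],$$ where $\mu$ ranges over all probability distributions on $\mathcal X$, $x_t\sim\mu$ and $\hat y_t\sim\Phi(x^t,y^{t-1})$ (expectations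 are upper expectations wherever an integrand fails to be measurable). The mixed ERM oracle for $\mathcal H$ returns, for labelled features $(x_i,y_i)\in\mathcal X\times[0,1]$, signed features $(\tilde x_j,\epsilon_j)\in\mathcal X\times\{-1,+1\}$ and a weight $c\ge 0$, the number $\inf_{h\in\mathcal H}\{\sum_i|h(x_i)-y_i|+c\sum_j\epsilon_jh(\tilde x_j)\}$. Algorithms are programs of a randomized random access machine with natural-number and real memory cells, rational constants, addition, subtraction, comparison, multiplication of reals by rational constants, and uniform random choice from $\{0,\dots,n\}$; features are accessible only through the oracle, and every instruction and every oracle call takes unit time. Such an algorithm is an oracle-efficient implementation of $\Phi$ if there is a polynomial $\tau$ such that, for every $t$ and every $x^t,y^{t-1}$, it always halts within $\tau(t)$ steps and its output has law $\Phi(x^t,y^{t-1})$. Let $$\mathcal F^{\mathsf u}=\Big\{x\mapsto\sup_{h\in\mathcal H'}h(x):\mathcal H'\subset\mathcal H\Big\},\qquad \mathcal F^{\mathsf i}=\Big\{x\mapsto\inf_{h\in\mathcal H'}h(x):\mathcal H'\subset\mathcal H\Big\},$$ with $\sup\emptyset=0$ and $\inf\emptyset=1$. **Theorem.** There are an absolute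 constant $C$, a single program $P$ and a single polynomial $\tau$ such that for all $\mathcal X$ and $\mathcal H$ as above there is a prediction rule $\Phi$ which $P$, given access to the mixed ERM oracle for $\mathcal H$, implements in time $\tau$, and which satisfies, whenever $\mathsf{VC}(\mathcal F^{\mathsf u})$ and $\mathsf{VC}(\mathcal F^{\mathsf i})$ are finite, $$\tilde r_T(\mathcal H,\Phi)\le C\sqrt{\max\{\mathsf{VC}(\mathcal F^{\mathsf u}),\mathsf{VC}(\mathcal F^{\mathsf i})\}\cdot T}\qquad\text{for all } T\ge 0 .$$ In particular, for the class $\mathcal H=\{x\mapsto 1\{x\ge a\}:a\in[0,1]\}$ of thresholds on $\mathcal X=[0,1]$ (with its Borel sets) the program $P$ implements in time $\tau$ a prediction rule $\Phi$ with $\tilde r_T(\mathcal H,\Phi)\le C\sqrt T$ for all $T\ge 0$. -/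

import Mathlib

open MeasureTheory
open scoped unitInterval NNReal

universe u

namespace HybridLearning

noncomputable section

/-! ### Binary classes, pointwise suprema and infima, VC dimension -/

/-- The real number `0` or `1` represented by a binary label. -/
def val (b : Bool) : ℝ := if b then 1 else 0

/-- Pointwise suprema over subfamilies of `H` (in the lattice `{0,1}` with `0 < 1`). -/
def supClass {X : Type u} (H : Set (X → Bool)) : Set (X → Bool) :=
  {f | ∃ H' ⊆ H, f = fun x => ⨆ h ∈ H', h x}

/-- Pointwise infima over subfamilies of `H`. -/
def infClass {X : Type u} (H : Set (X → Bool)) : Set (X → Bool) :=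
  {f | ∃ H' ⊆ H, f = fun x => ⨅ h ∈ H', h x}

/-- `F` shatters the finite set `s`: every labelling of `s` is realised by a member of `F`. -/
def Shatters {X : Type u} (F : Set (X → Bool)) (s : Finset X) : Prop :=
  ∀ b : X → Bool, ∃ f ∈ F, ∀ x ∈ s, f x = b x

/-- The Vapnik–Chervonenkis dimension, `⊤` if arbitrarily large finite sets are shattered. -/
def vcDim {X : Type u} (F : Set (X → Bool)) : ℕ∞ :=
  ⨆ s : {s : Finset X // Shatters F s}, (s.1.card : ℕ∞)

/-- Threshold functions `x ↦ 1{x ≥ a}` on `[0,1]`, with `a ∈ [0,1]`. -/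
def thresholds : Set (I → Bool) :=
  {h | ∃ a : I, h = fun x => decide (a ≤ x)}

/-! ### The hybrid minimax regret under absolute loss -/

/-- The least cumulative absolute loss of a member of `H` on the labelled sample `(x, y)`. -/
def bestLoss {X : Type u} (H : Set (X → Bool)) {n : ℕ} (x : Fin n → X) (y : Fin n → I) : ℝ :=
  ⨅ h : H, ∑ i, |val (h.1 (x i)) - (y i : ℝ)|

/-- The regularity needed for the expectations in the regret to make sense: for fixed labels the
benchmark `inf_h ∑ |h(x_i) - y_i|` is a measurable function of the features. -/
def MeasurableClass {X : Type u} [MeasurableSpace X] (H : Set (X → Bool)) : Prop :=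
  ∀ (n : ℕ) (y : Fin n → I), Measurable fun x : Fin n → X => bestLoss H x y

/-- A prediction rule: from the features `x₀, …, x_t` and the labels `y₀, …, y_{t-1}` it produces
a distribution on `[0,1]`. -/
abbrev PredictionRule (X : Type u) : Type u :=
  (t : ℕ) → (Fin (t + 1) → X) → (Fin t → I) → ProbabilityMeasure I

/-- The (upper) expectation of a bounded function. For an integrable function it is the usual
integral, see `upperExp_eq_integral`; for a bounded function that fails to be measurable it is the
upper integral, so that no measurability of a supremum over labels has to be presupposed. -/
def upperExp {α : Type*} [MeasurableSpace α] (μ : Measure α) (f : α → ℝ) : ℝ :=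
  ⨅ g : {g : α → ℝ // Integrable g μ ∧ ∀ a, f a ≤ g a}, ∫ a, g.1 a ∂μ

theorem upperExp_eq_integral {α : Type*} [MeasurableSpace α] (μ : Measure α) (f : α → ℝ)
    (hf : Integrable f μ) : upperExp μ f = ∫ a, f a ∂μ := by
  have hlb : ∀ g : {g : α → ℝ // Integrable g μ ∧ ∀ a, f a ≤ g a},
      ∫ a, f a ∂μ ≤ ∫ a, g.1 a ∂μ := fun g => integral_mono hf g.2.1 g.2.2
  refine le_antisymm ?_ ?_
  · exact ciInf_le ⟨_, Set.forall_mem_range.2 hlb⟩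
      (⟨f, hf, fun _ => le_rfl⟩ : {g : α → ℝ // Integrable g μ ∧ ∀ a, f a ≤ g a})
  · have : Nonempty {g : α → ℝ // Integrable g μ ∧ ∀ a, f a ≤ g a} :=
      ⟨⟨f, hf, fun _ => le_rfl⟩⟩
    exact le_ciInf hlb

/-- The value of the game with `k` rounds to go, after `t` rounds with features `x`, labels `y` and
predictions `p`. In each round a feature is drawn from `μ`, the adversary picks a label knowing the
whole past and the feature, and the prediction is drawn from `Φ`. When no round is left, the value
is the regret `∑ |p_i - y_i| - inf_h ∑ |h(x_i) - y_i|`. -/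
def gameValue {X : Type u} [MeasurableSpace X] (H : Set (X → Bool)) (Φ : PredictionRule X)
    (μ : Measure X) :
    (k t : ℕ) → (Fin t → X) → (Fin t → I) → (Fin t → I) → ℝ
  | 0, _, x, y, p => (∑ i, |(p i : ℝ) - (y i : ℝ)|) - bestLoss H x y
  | k + 1, t, x, y, p =>
      upperExp μ fun x' =>
        ⨆ y' : I,
          upperExp (Φ t (Fin.snoc x x') y : Measure I) fun p' =>
            gameValue H Φ μ k (t + 1) (Fin.snoc x x') (Fin.snoc y y') (Fin.snoc p p')

/-- The hybrid minimax regret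
`sup_μ E_{x₁} sup_{y₁} E_{p₁} ⋯ E_{x_T} sup_{y_T} E_{p_T} [∑ |p_t - y_t| - inf_h ∑ |h(x_t) - y_t|]`,
where `μ` ranges over all probability distributions on `X`. -/
def regret {X : Type u} [MeasurableSpace X] (H : Set (X → Bool)) (Φ : PredictionRule X)
    (T : ℕ) : ℝ :=
  ⨆ μ : ProbabilityMeasure X, gameValue H Φ (μ : Measure X) T 0 ![] ![] ![]

/-! ### Randomised oracle machines

A random access machine with a memory of natural numbers, a memory of real numbers, and a query
tape for the mixed ERM oracle. Arithmetic is limited to sums and differences, rational constants and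
multiplication of reals by rational constants. Features are opaque: a program refers to them only
by their index, and learns about them (and about the class) only through the oracle. -/

/-- Expressions with natural values; `read e` is the content of the cell with address `e`. -/
inductive NatExpr : Type
  | const (c : ℕ)
  | read (a : NatExpr)
  | add (e f : NatExpr)
  | sub (e f : NatExpr)

/-- Expressions with real values; `read a` is the content of the real cell with address `a`. -/
inductive RealExpr : Type
  | const (c : ℚ)
  | read (a : NatExpr)
  | add (e f : RealExpr)
  | sub (e f : RealExpr)
  | scale (c : ℚ) (e : RealExpr)

/-- Programs. Loops are bounded: `loop e P` evaluates `e` once and then runs `P` that many times. -/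
inductive Program : Type
  | skip
  /-- write a natural number into the cell with address `a` -/
  | setNat (a e : NatExpr)
  /-- write a real number into the real cell with address `a` -/
  | setReal (a : NatExpr) (e : RealExpr)
  /-- write a uniformly random element of `{0, …, e}` into the cell with address `a` -/
  | rand (a e : NatExpr)
  /-- put the labelled sample `(x_i, y)` on the query tape -/
  | pushSample (i : NatExpr) (y : RealExpr)
  /-- put the signed sample `ε h(x_i)` on the query tape -/
  | pushSign (ε : ℤˣ) (i : NatExpr)
  /-- call the oracle with weight `c` on the query tape, write its answer into the real cell with
  address `a`, and erase the query tape -/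
  | ask (a : NatExpr) (c : RealExpr)
  | seq (P Q : Program)
  /-- run `P` if `e ≤ f` and `Q` otherwise -/
  | iteNat (e f : NatExpr) (P Q : Program)
  /-- run `P` if `e ≤ f` and `Q` otherwise -/
  | iteReal (e f : RealExpr) (P Q : Program)
  | loop (e : NatExpr) (P : Program)

/-- The contents of the query tape, when the features `x₀, …, x_t` are available. -/
structure Query (t : ℕ) where
  samples : List (Fin (t + 1) × I)
  signs : List (Fin (t + 1) × ℤˣ)

/-- The mixed ERM oracle for the absolute loss:
`inf_h { ∑ |h(x_i) - y_i| + c ∑ ε_j h(x_j) }`, with `c ≥ 0`. -/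
def mixedERM {X : Type u} (H : Set (X → Bool)) {t : ℕ} (x : Fin (t + 1) → X)
    (q : Query t) (c : ℝ≥0) : ℝ :=
  ⨅ h : H,
    ((q.samples.map fun s => |val (h.1 (x s.1)) - (s.2 : ℝ)|).sum
      + c * (q.signs.map fun s => ((s.2 : ℤ) : ℝ) * val (h.1 (x s.1))).sum)

/-- A configuration of the machine; `time` counts the steps made so far. -/
structure State (t : ℕ) where
  nat : ℕ → ℕ
  real : ℕ → ℝ
  query : Query t
  time : ℕ

/-- One more step. -/
def State.tick {t : ℕ} (s : State t) : State t := { s with time := s.time + 1 }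

def NatExpr.eval {t : ℕ} (s : State t) : NatExpr → ℕ
  | .const c => c
  | .read a => s.nat (a.eval s)
  | .add e f => e.eval s + f.eval s
  | .sub e f => e.eval s - f.eval s

def RealExpr.eval {t : ℕ} (s : State t) : RealExpr → ℝ
  | .const c => (c : ℝ)
  | .read a => s.real (a.eval s)
  | .add e f => e.eval s + f.eval s
  | .sub e f => e.eval s - f.eval s
  | .scale c e => (c : ℝ) * e.eval s

/-- The index `i` of a feature, cut off at the largest available index `t`. -/
def clampIdx (t i : ℕ) : Fin (t + 1) := ⟨min i t, Nat.lt_succ_of_le (min_le_right i t)⟩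

/-- The execution of a program, as a distribution over final configurations. Each elementary
instruction, each oracle call, each test and each pass of a loop takes one step; an expression in a
program has a fixed size and is evaluated within the step of its instruction. Arguments outside the
domain of the oracle (an index `> t`, a label outside `[0,1]`, a negative weight) are replaced by
the nearest admissible ones. -/
def Program.exec {t : ℕ} (oracle : Query t → ℝ≥0 → ℝ) : Program → State t → PMF (State t)
  | .skip, s => PMF.pure s.tick
  | .setNat a e, s =>
      PMF.pure { s.tick with nat := Function.update s.nat (a.eval s) (e.eval s) }
  | .setReal a e, s =>
      PMF.pure { s.tick with real := Function.update s.real (a.eval s) (e.eval s) }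
  | .rand a e, s =>
      (PMF.uniformOfFintype (Fin (e.eval s + 1))).map fun r =>
        { s.tick with nat := Function.update s.nat (a.eval s) (r : ℕ) }
  | .pushSample i y, s =>
      PMF.pure { s.tick with
        query := { s.query with
          samples := (clampIdx t (i.eval s), Set.projIcc 0 1 zero_le_one (y.eval s)) ::
            s.query.samples } }
  | .pushSign ε i, s =>
      PMF.pure { s.tick with
        query := { s.query with signs := (clampIdx t (i.eval s), ε) :: s.query.signs } }
  | .ask a c, s =>
      PMF.pure { s.tick with
        real := Function.update s.real (a.eval s) (oracle s.query (c.eval s).toNNReal)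
        query := ⟨[], []⟩ }
  | .seq P Q, s => (P.exec oracle s).bind (Q.exec oracle)
  | .iteNat e f P Q, s =>
      if e.eval s ≤ f.eval s then P.exec oracle s.tick else Q.exec oracle s.tick
  | .iteReal e f P Q, s =>
      if e.eval s ≤ f.eval s then P.exec oracle s.tick else Q.exec oracle s.tick
  | .loop e P, s =>
      Nat.rec (PMF.pure s.tick) (fun _ D => D.bind fun s' => P.exec oracle s'.tick) (e.eval s)

/-- The initial configuration: cell `0` holds `t`, the real cells `0, …, t-1` hold the labels
`y₀, …, y_{t-1}`, everything else is zero or empty. -/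
def initState {t : ℕ} (y : Fin t → I) : State t where
  nat := fun a => if a = 0 then t else 0
  real := fun a => if h : a < t then (y ⟨a, h⟩ : ℝ) else 0
  query := ⟨[], []⟩
  time := 0

/-- The run of a program on the history `(x₀, …, x_t)`, `(y₀, …, y_{t-1})`, with the mixed ERM
oracle for `H`. -/
def Program.run {X : Type u} (P : Program) (H : Set (X → Bool)) {t : ℕ} (x : Fin (t + 1) → X)
    (y : Fin t → I) : PMF (State t) :=
  P.exec (mixedERM H x) (initState y)

/-- The program `P`, with oracle access to `H`, computes the prediction rule `Φ` in time `τ`: on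
every history of every length `t`, each run of `P` takes at most `τ(t)` steps, and the law of the
number that `P` leaves in the real cell `0` is the distribution that `Φ` prescribes. -/
def ComputesInTime {X : Type u} (P : Program) (τ : Polynomial ℕ) (H : Set (X → Bool))
    (Φ : PredictionRule X) : Prop :=
  ∀ (t : ℕ) (x : Fin (t + 1) → X) (y : Fin t → I),
    (∀ s ∈ (P.run H x y).support, s.time ≤ τ.eval t) ∧
      ((P.run H x y).map fun s => s.real 0).toMeasure
        = (Φ t x y : Measure I).map ((↑) : I → ℝ)

end

end HybridLearning

open scoped BigOperators

namespace HybridLearning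

/-! ### Rademacher averages of classes of bounded VC dimension -/

/-! The rule is a random playout organised in epochs between consecutive powers of two. In the epoch
with M = `scale t` the first M features form a fixed pool. To the loss of the past the learner adds
2M - (t + 1) random terms ε h(w), with fair signs ε and points w drawn uniformly from the pool: one
term for each later round of the epoch. The prediction `balance` then equalises the two extreme
labels. Since |h(x) - y| is affine in y for binary h, intermediate labels are no worse for the
learner, and what is left (`abs_balance_sub_le`) is the average over a fair sign ε of -inf_h (g(h) +
ε h(x)), where x is the new feature and g the perturbed loss.

The potential `-relax` before the round has the same form with one draw more, so it remains to
exchange the fresh feature for a uniform draw from the pool. Here g depends on the whole history,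
the pool included, so the comparison has to be uniform in g. This is where suprema and infima of
subfamilies enter: by the layer-cake formula, the superlevel sets of x ↦ sup_h (h(x) - g(h)) are
members of F^u, up to a shift by a constant (`sum_iSup_sub_le_gap`). For the opposite sign one
passes to complements, which turns F^u into the complements of F^i. The error is therefore at most
`meanGap` over M, which depends on the pool alone. The pool is an i.i.d. sample, and symmetrisation
bounds the mean of `meanGap` by O(√(dM)) (`integral_meanGap_le`).

Thus a round costs O(√(d/M)) and an epoch O(√(dM)). Opening an epoch costs one Rademacher average of
H, again O(√(dM)) (`iInf_le_relax_add`), because the playout then starts with M terms. The epochs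
sum geometrically to O(√(dT)) (`gameValue_le`, `sum_meanCost_le`).

That no logarithm appears is due to `expect_sign_traces_le`, proved by chaining. It rests on the
packing bound `log_card_separated_le`: at relative scale 16^{-k} a separated set of traces has
logarithmic size at most 8 d 4^k. This is weaker than Haussler's bound but summable.

On the computational side the prediction is an affine function of two oracle answers with weight 1,
and each draw is one uniform integer, so a linear number of steps suffices (`run_ruleProgram`). -/

/-- The sign `1` or `-1` represented by a Boolean. -/
def sgn (b : Bool) : ℝ := if b then 1 else -1

theorem sgn_not (b : Bool) : sgn (!b) = -sgn b := by cases b <;> simp [sgn]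

theorem val_not (b : Bool) : val (!b) = 1 - val b := by cases b <;> simp [val]

theorem val_nonneg (b : Bool) : 0 ≤ val b := by cases b <;> simp [val]

theorem val_le_one (b : Bool) : val b ≤ 1 := by cases b <;> simp [val]

/-- Every finite set shattered by `F` has at most `d` elements. -/
def VCLe {X : Type u} (F : Set (X → Bool)) (d : ℕ) : Prop :=
  ∀ s : Finset X, Shatters F s → s.card ≤ d

/-- The restrictions of the members of `F` to the points `z i`. -/
def traces {X ι : Type*} (F : Set (X → Bool)) (z : ι → X) : Set (ι → Bool) :=
  {b | ∃ f ∈ F, ∀ i, f (z i) = b i}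

/-- On a shattered set of indices the points `z i` are distinct, because some trace cuts out a
single index. The image points are then shattered by `F`. -/
theorem vcDim_le_of_subset_traces {X : Type u} {F : Set (X → Bool)} {d k : ℕ} (hF : VCLe F d)
    (z : Fin k → X) (A : Finset (Fin k → Bool)) (hA : ↑A ⊆ traces F z) :
    (A.image fun a => Finset.univ.filter fun i => a i = true).vcDim ≤ d := by
  classical
  refine Finset.sup_le fun s hs => ?_
  rw [Finset.mem_shatterer] at hs
  have hs' : ∀ t ⊆ s, ∃ f ∈ F, ∀ i ∈ s, f (z i) = true ↔ i ∈ t := by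
    intro t ht
    obtain ⟨u, hu, hut⟩ := hs ht
    obtain ⟨a, ha, rfl⟩ := Finset.mem_image.1 hu
    obtain ⟨f, hf, hfa⟩ := hA ha
    refine ⟨f, hf, fun i hi => ?_⟩
    rw [hfa i, ← hut]
    simp [hi]
  have hinj : Set.InjOn z s := by
    intro i hi j hj hij
    obtain ⟨f, -, hf⟩ := hs' {i} (by simpa using hi)
    have h1 := (hf i hi).2 (by simp)
    have h2 := (hf j hj).1 (by rw [← hij]; exact h1)
    exact (Finset.mem_singleton.1 h2).symm
  rw [← Finset.card_image_of_injOn hinj]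
  refine hF _ fun b => ?_
  obtain ⟨f, hf, hfb⟩ := hs' (s.filter fun i => b (z i) = true) (Finset.filter_subset _ _)
  refine ⟨f, hf, fun x hx => ?_⟩
  obtain ⟨i, hi, rfl⟩ := Finset.mem_image.1 hx
  have := hfb i hi
  rw [Finset.mem_filter] at this
  rw [Bool.eq_iff_iff, this]
  simp [hi]

/-- Sauer–Shelah with a free parameter: for x ≤ 1 each x^i with i ≤ d is at least x^d, so x^d times
the binomial sum is at most (1 + x)^k. The optimal `x` is chosen by the user of the lemma. -/
theorem card_traces_le {X : Type u} {F : Set (X → Bool)} {d k : ℕ} (hF : VCLe F d)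
    (z : Fin k → X) (A : Finset (Fin k → Bool)) (hA : ↑A ⊆ traces F z) {x : ℝ} (hx : 0 < x)
    (hx1 : x ≤ 1) : x ^ d * A.card ≤ Real.exp (x * k) := by
  classical
  set 𝒜 := A.image fun a => Finset.univ.filter fun i => a i = true with h𝒜
  have hcard : 𝒜.card = A.card := by
    refine Finset.card_image_of_injective _ fun a b hab => ?_
    funext i
    have := congrArg (fun s : Finset (Fin k) => i ∈ s) hab
    simp only [Finset.mem_filter, Finset.mem_univ, true_and, eq_iff_iff] at this
    exact Bool.eq_iff_iff.2 this
  have h1 : A.card ≤ ∑ i ∈ Finset.Iic d, k.choose i := by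
    rw [← hcard]
    refine (Finset.card_le_card_shatterer 𝒜).trans (Finset.card_shatterer_le_sum_vcDim.trans ?_)
    rw [Fintype.card_fin]
    exact Finset.sum_le_sum_of_subset
      (Finset.Iic_subset_Iic.2 (vcDim_le_of_subset_traces hF z A hA))
  calc x ^ d * A.card ≤ x ^ d * ∑ i ∈ Finset.Iic d, (k.choose i : ℝ) := by
        gcongr; exact_mod_cast h1
    _ = ∑ i ∈ Finset.Iic d, x ^ d * (k.choose i : ℝ) := Finset.mul_sum _ _ _
    _ ≤ ∑ i ∈ Finset.Iic d, x ^ i * (k.choose i : ℝ) := by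
        refine Finset.sum_le_sum fun i hi => ?_
        gcongr ?_ * _
        exact pow_le_pow_of_le_one hx.le hx1 (Finset.mem_Iic.1 hi)
    _ ≤ ∑ i ∈ Finset.range (k + 1 + d), x ^ i * (k.choose i : ℝ) := by
        refine Finset.sum_le_sum_of_subset_of_nonneg (fun i hi => ?_) fun i _ _ => by positivity
        simp only [Finset.mem_Iic, Finset.mem_range] at *
        omega
    _ = ∑ i ∈ Finset.range (k + 1), x ^ i * (k.choose i : ℝ) := by
        refine (Finset.sum_subset (Finset.range_mono (by omega)) fun i _ hi => ?_).symm
        rw [Nat.choose_eq_zero_of_lt (by simpa using hi)]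
        simp
    _ = (x + 1) ^ k := by rw [add_pow]; simp
    _ ≤ Real.exp x ^ k := by gcongr; exact Real.add_one_le_exp x
    _ = Real.exp (x * k) := by rw [mul_comm, Real.exp_nat_mul]

/-! ### Packing numbers of classes of bounded VC dimension. -/

/-- A separated family is separated by few of its coordinates. -/
theorem exists_injOn_comp {n : ℕ} (A : Finset (Fin n → Bool)) {δ : ℝ}
    (hA : ∀ a ∈ A, ∀ b ∈ A, a ≠ b → δ * n ≤ hammingDist a b) (k : ℕ)
    (hk : 2 * Real.log A.card ≤ δ * k) (hA0 : A.Nonempty) :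
    n = 0 ∨ ∃ s : Fin k → Fin n, Set.InjOn (fun a : Fin n → Bool => a ∘ s) A := by
  classical
  rcases Nat.eq_zero_or_pos n with hn | hn
  · exact Or.inl hn
  right
  by_contra! hcon
  set agree : (Fin n → Bool) × (Fin n → Bool) → Finset (Fin n) :=
    fun p => Finset.univ.filter fun i => p.1 i = p.2 i with hagree
  -- Union bound in counting form. If no choice `s` of k coordinates works, the n^k choices are
  -- covered by those on which some ordered pair agrees. A pair accounts for at most (n e^{-δ})^k ≤
  -- n^k / N² of them, and there are only N(N - 1) pairs.
  have hsub : (Finset.univ : Finset (Fin k → Fin n)) ⊆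
      A.offDiag.biUnion fun p => Fintype.piFinset fun _ => agree p := by
    intro s _
    have := hcon s
    simp only [Set.InjOn, not_forall] at this
    obtain ⟨a, ha, b, hb, hab, hne⟩ := this
    refine Finset.mem_biUnion.2 ⟨(a, b), Finset.mem_offDiag.2 ⟨ha, hb, hne⟩, ?_⟩
    refine Fintype.mem_piFinset.2 fun j => ?_
    simpa [hagree] using congrFun hab j
  have hcard := (Finset.card_le_card hsub).trans Finset.card_biUnion_le
  simp only [Fintype.card_piFinset_const, Finset.card_univ, Fintype.card_fun, Fintype.card_fin]
    at hcard
  have hN : (0 : ℝ) < A.card := by exact_mod_cast hA0.card_pos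
  have hpair : ∀ p ∈ A.offDiag, ((agree p).card : ℝ) ^ k ≤ n ^ k / (A.card : ℝ) ^ 2 := by
    rintro ⟨a, b⟩ hp
    obtain ⟨ha, hb, hne⟩ := Finset.mem_offDiag.1 hp
    have h1 : (agree (a, b)).card + hammingDist a b = n := by
      have := Finset.card_filter_add_card_filter_not (s := (Finset.univ : Finset (Fin n)))
        (fun i => a i = b i)
      simpa [hammingDist, hagree] using this
    have h2 : ((agree (a, b)).card : ℝ) ≤ n * Real.exp (-δ) := by
      have h3 : ((agree (a, b)).card : ℝ) + hammingDist a b = n := by exact_mod_cast h1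
      have h4 := hA a ha b hb hne
      have h5 := Real.add_one_le_exp (-δ)
      have h6 : (n : ℝ) * (-δ + 1) ≤ n * Real.exp (-δ) := by gcongr
      linarith
    calc ((agree (a, b)).card : ℝ) ^ k ≤ (n * Real.exp (-δ)) ^ k := by gcongr
      _ = n ^ k * Real.exp (-(δ * k)) := by
          rw [mul_pow, ← Real.exp_nat_mul]; ring_nf
      _ ≤ n ^ k * Real.exp (-(2 * Real.log A.card)) := by gcongr
      _ = n ^ k / (A.card : ℝ) ^ 2 := by
          rw [Real.exp_neg, two_mul, Real.exp_add, Real.exp_log hN, div_eq_mul_inv, sq]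
  have hlt : (n : ℝ) ^ k < n ^ k := by
    calc (n : ℝ) ^ k ≤ ∑ p ∈ A.offDiag, ((agree p).card : ℝ) ^ k := by exact_mod_cast hcard
      _ ≤ ∑ p ∈ A.offDiag, (n : ℝ) ^ k / (A.card : ℝ) ^ 2 := Finset.sum_le_sum hpair
      _ = (A.card * A.card - A.card : ℝ) * (n ^ k / (A.card : ℝ) ^ 2) := by
          rw [Finset.sum_const, nsmul_eq_mul, Finset.offDiag_card,
            Nat.cast_sub (Nat.le_mul_self _), Nat.cast_mul]
      _ < n ^ k := by
          rw [mul_div_assoc', div_lt_iff₀ (by positivity)]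
          have : (0 : ℝ) < n ^ k := by positivity
          nlinarith [mul_pos hN this]
  exact lt_irrefl _ hlt

/-- A bound for the size of separated sets of traces. -/
theorem log_card_separated_le {X : Type u} {F : Set (X → Bool)} {d n : ℕ} (hd : 1 ≤ d)
    (hF : VCLe F d) (z : Fin n → X) (A : Finset (Fin n → Bool)) (hA : ↑A ⊆ traces F z)
    (k : ℕ) (hsep : ∀ a ∈ A, ∀ b ∈ A, a ≠ b → (16 : ℝ)⁻¹ ^ k * n ≤ hammingDist a b) :
    Real.log A.card ≤ 8 * d * 4 ^ k := by
  classical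
  have hd' : (1 : ℝ) ≤ d := by exact_mod_cast hd
  rcases A.eq_empty_or_nonempty with rfl | hA0
  · simp
  have hN : (0 : ℝ) < A.card := by exact_mod_cast hA0.card_pos
  have hN1 : (1 : ℝ) ≤ A.card := by exact_mod_cast hA0.card_pos
  set L := Real.log A.card with hL
  have hL0 : 0 ≤ L := Real.log_nonneg hN1
  -- The number of coordinates that `exists_injOn_comp` needs at separation 16^{-k}. It involves `L`
  -- itself, so Sauer–Shelah on these coordinates gives an implicit inequality for `L`.
  set m := ⌈2 * L * 16 ^ k⌉₊ with hm
  have hm1 : 2 * L * 16 ^ k ≤ m := Nat.le_ceil _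
  have hm2 : (m : ℝ) < 2 * L * 16 ^ k + 1 := Nat.ceil_lt_add_one (by positivity)
  have h16 : (16 : ℝ)⁻¹ ^ k * 16 ^ k = 1 := by rw [← mul_pow]; norm_num
  have hone : (1 : ℝ) ≤ 4 ^ k := one_le_pow₀ (by norm_num)
  rcases exists_injOn_comp A (δ := (16 : ℝ)⁻¹ ^ k) hsep m (by
      calc 2 * L = (16 : ℝ)⁻¹ ^ k * (2 * L * 16 ^ k) := by linear_combination (-2 * L) * h16
        _ ≤ _ := by gcongr) hA0 with rfl | ⟨s, hs⟩
  · have : A.card ≤ 1 := (Finset.card_le_one_of_subsingleton A)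
    have h1 : (A.card : ℝ) = 1 := le_antisymm (by exact_mod_cast this) hN1
    rw [hL, h1, Real.log_one]; positivity
  have hcard : (A.image fun a => a ∘ s).card = A.card := Finset.card_image_of_injOn hs
  have htr : ↑(A.image fun a => a ∘ s) ⊆ traces F (z ∘ s) := by
    intro b hb
    obtain ⟨a, ha, rfl⟩ := Finset.mem_image.1 hb
    obtain ⟨f, hf, hfa⟩ := hA ha
    exact ⟨f, hf, fun i => hfa _⟩
  have key : ∀ x : ℝ, 0 < x → x ≤ 1 → d * Real.log x + L ≤ x * m := by
    intro x hx hx1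
    have := card_traces_le hF (z ∘ s) _ htr hx hx1
    rw [hcard] at this
    have h2 := Real.log_le_log (by positivity) this
    rwa [Real.log_exp, Real.log_mul (by positivity) (by positivity), Real.log_pow] at h2
  -- it suffices to bound the normalised logarithm
  set y := L / d with hy
  have hLy : L = y * d := by rw [hy]; field_simp
  have hy0 : 0 ≤ y := by positivity
  have hz : y ^ 2 ≤ 54 * 16 ^ k := by
    have h16' : (1 : ℝ) ≤ 16 ^ k := one_le_pow₀ (by norm_num)
    rcases le_or_gt y 1 with hy1 | hy1
    · nlinarith
    have hmd : (d : ℝ) ≤ m := by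
      by_contra! hlt
      have := key 1 one_pos le_rfl
      rw [Real.log_one] at this
      nlinarith
    have hm0 : (0 : ℝ) < m := by linarith
    -- The optimal parameter x = d/m gives L ≤ d (1 + log (m/d)); that it is at most 1 came from the
    -- case x = 1.
    have h1 := key (d / m) (by positivity) ((div_le_one hm0).2 hmd)
    rw [Real.log_div (by positivity) (by positivity), div_mul_cancel₀ _ hm0.ne', hLy] at h1
    have h2 : y - 1 ≤ Real.log (m / d) := by
      rw [Real.log_div (by positivity) (by positivity)]
      have : d * (y - 1) ≤ d * (Real.log m - Real.log d) := by linarith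
      exact le_of_mul_le_mul_left this (by positivity)
    have h3 : Real.exp (y - 1) ≤ m / d := by
      rwa [← Real.le_log_iff_exp_le (by positivity)]
    have h4 : (m : ℝ) / d ≤ 3 * y * 16 ^ k := by
      rw [div_le_iff₀ (by positivity)]
      have h5 : (1 : ℝ) ≤ y * d * 16 ^ k := by
        have : (1 : ℝ) ≤ y * d := by nlinarith
        nlinarith
      rw [hLy] at hm2
      nlinarith
    have h6 : Real.exp y ≤ 3 * Real.exp (y - 1) := by
      rw [show y = 1 + (y - 1) by ring, Real.exp_add, show 1 + (y - 1) - 1 = y - 1 by ring]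
      gcongr
      exact (Real.exp_one_lt_d9.trans (by norm_num)).le
    -- The cubic term of the exponential beats the linear right-hand side: y³/6 ≤ e^y ≤ 9 y 16^k,
    -- whence the 54.
    have h7 := Real.pow_div_factorial_le_exp y hy0 3
    have h8 : y ^ 3 ≤ y * (54 * 16 ^ k) := by
      have : ((Nat.factorial 3 : ℕ) : ℝ) = 6 := by norm_num [Nat.factorial]
      rw [this] at h7
      linarith
    have : y * y ^ 2 ≤ y * (54 * 16 ^ k) := by linarith [h8, show y * y ^ 2 = y ^ 3 by ring]
    exact le_of_mul_le_mul_left this (by linarith)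
  have hy8 : y ≤ 8 * 4 ^ k := by
    refine le_of_sq_le_sq ?_ (by positivity)
    have : (16 : ℝ) ^ k = (4 ^ k) ^ 2 := by rw [← pow_mul, mul_comm, pow_mul]; norm_num
    rw [this] at hz
    nlinarith [sq_nonneg ((4 : ℝ) ^ k)]
  rw [hLy]
  nlinarith

/-- A maximal separated subset is a net. -/
theorem exists_net {n : ℕ} (r : ℝ) (hr : 0 < r) (A : Finset (Fin n → Bool)) :
    ∃ B ⊆ A, (∀ a ∈ B, ∀ b ∈ B, a ≠ b → r ≤ hammingDist a b) ∧
      ∀ a ∈ A, ∃ b ∈ B, (hammingDist a b : ℝ) < r := by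
  classical
  induction A using Finset.induction_on with
  | empty => exact ⟨∅, by simp, by simp, by simp⟩
  | insert a A _ ih =>
    obtain ⟨B, hBA, hsep, hnet⟩ := ih
    by_cases h : ∃ b ∈ B, (hammingDist a b : ℝ) < r
    · refine ⟨B, hBA.trans (Finset.subset_insert _ _), hsep, fun a' ha' => ?_⟩
      rcases Finset.mem_insert.1 ha' with rfl | ha'
      · exact h
      · exact hnet a' ha'
    · push Not at h
      refine ⟨insert a B, Finset.insert_subset_insert _ hBA, ?_, ?_⟩
      · intro x hx y hy hxy
        rcases Finset.mem_insert.1 hx with rfl | hx' <;>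
          rcases Finset.mem_insert.1 hy with rfl | hy'
        · exact absurd rfl hxy
        · exact h y hy'
        · rw [hammingDist_comm]; exact h _ hx'
        · exact hsep x hx' y hy' hxy
      · intro a' ha'
        rcases Finset.mem_insert.1 ha' with rfl | ha'
        · exact ⟨a', Finset.mem_insert_self _ _, by simpa using hr⟩
        · obtain ⟨b, hb, hab⟩ := hnet a' ha'
          exact ⟨b, Finset.mem_insert_of_mem hb, hab⟩

/-! ### Chaining. -/

/-- Massart's finite class lemma, for a selection from a finite family of vectors. -/
theorem expect_sign_le {n : ℕ} {ι : Type*} (V : Finset ι) (v : ι → Fin n → ℝ) {R lam : ℝ}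
    (hlam : 0 < lam) (hR : ∀ j ∈ V, ∑ i, v j i ^ 2 ≤ R) (c : (Fin n → Bool) → ι)
    (hc : ∀ ε, c ε ∈ V) :
    𝔼 ε : Fin n → Bool, ∑ i, sgn (ε i) * v (c ε) i
      ≤ Real.log V.card / lam + lam * R / 2 := by
  classical
  have hV : (0 : ℝ) < V.card := by
    exact_mod_cast Finset.card_pos.2 ⟨_, hc fun _ => true⟩
  -- `C` is chosen so that the means of the exponentials exp(λ⟨ε, v_j⟩ - C) add up to at most 1.
  -- Then e^u ≥ 1 + u replaces the usual use of Jensen's inequality for the logarithm.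
  set C := Real.log V.card + lam ^ 2 * R / 2 with hC
  have hpt : ∀ ε : Fin n → Bool, lam * ∑ i, sgn (ε i) * v (c ε) i
      ≤ ∑ j ∈ V, Real.exp (lam * (∑ i, sgn (ε i) * v j i) - C) + (C - 1) := by
    intro ε
    have h1 := Real.add_one_le_exp (lam * (∑ i, sgn (ε i) * v (c ε) i) - C)
    have h2 := Finset.single_le_sum
      (f := fun j => Real.exp (lam * (∑ i, sgn (ε i) * v j i) - C))
      (fun j _ => (Real.exp_pos _).le) (hc ε)
    linarith
  have hmgf : ∀ j ∈ V, 𝔼 ε : Fin n → Bool, Real.exp (lam * (∑ i, sgn (ε i) * v j i) - C)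
      ≤ Real.exp (lam ^ 2 * R / 2 - C) := by
    intro j hj
    have h1 : ∑ ε : Fin n → Bool, Real.exp (lam * (∑ i, sgn (ε i) * v j i))
        = ∏ i, (2 * Real.cosh (lam * v j i)) := by
      have : ∀ i, 2 * Real.cosh (lam * v j i) = ∑ b : Bool, Real.exp (lam * (sgn b * v j i)) := by
        intro i
        rw [Real.cosh_eq, Fintype.sum_bool]
        simp [sgn]
        ring
      simp_rw [this, Finset.prod_univ_sum, Fintype.piFinset_univ, Finset.mul_sum, Real.exp_sum]
    have h2 : ∏ i, (2 * Real.cosh (lam * v j i)) ≤ 2 ^ n * Real.exp (lam ^ 2 * R / 2) := by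
      rw [Finset.prod_mul_distrib, Finset.prod_const, Finset.card_univ, Fintype.card_fin]
      gcongr
      calc ∏ i, Real.cosh (lam * v j i) ≤ ∏ i, Real.exp ((lam * v j i) ^ 2 / 2) :=
            Finset.prod_le_prod (fun i _ => (Real.cosh_pos _).le)
              fun i _ => Real.cosh_le_exp_half_sq _
        _ = Real.exp (lam ^ 2 * (∑ i, v j i ^ 2) / 2) := by
            rw [← Real.exp_sum, ← Finset.sum_div, Finset.mul_sum]
            simp_rw [mul_pow]
        _ ≤ _ := by gcongr; exact hR j hj
    rw [Fintype.expect_eq_sum_div_card, Fintype.card_fun, Fintype.card_bool, Fintype.card_fin,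
      div_le_iff₀ (by positivity)]
    simp_rw [Real.exp_sub, ← Finset.sum_div]
    rw [h1, div_mul_eq_mul_div]
    gcongr
    push_cast
    linarith
  have hsum : lam * 𝔼 ε : Fin n → Bool, ∑ i, sgn (ε i) * v (c ε) i ≤ C := by
    rw [Finset.mul_expect]
    refine (Finset.expect_le_expect fun ε _ => hpt ε).trans ?_
    rw [Finset.expect_add_distrib, Finset.expect_sum_comm, Fintype.expect_const]
    have h1 := Finset.sum_le_sum hmgf
    rw [Finset.sum_const, nsmul_eq_mul] at h1
    have h2 : (V.card : ℝ) * Real.exp (lam ^ 2 * R / 2 - C) = 1 := by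
      rw [hC, show lam ^ 2 * R / 2 - (Real.log V.card + lam ^ 2 * R / 2) = -Real.log V.card by ring,
        Real.exp_neg, Real.exp_log hV]
      field_simp
    linarith
  rw [show Real.log V.card / lam + lam * R / 2 = C / lam by rw [hC]; field_simp,
    le_div_iff₀ hlam]
  linarith

theorem sum_sq_val_sub {n : ℕ} (a b : Fin n → Bool) :
    ∑ i, (val (a i) - val (b i)) ^ 2 = hammingDist a b := by
  classical
  rw [hammingDist, Finset.card_filter, Nat.cast_sum]
  refine Finset.sum_congr rfl fun i _ => ?_
  cases a i <;> cases b i <;> simp [val]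

theorem log_card_filter_product_le {α β : Type*} (A : Finset α) (B : Finset β) (p : α × β → Prop)
    [DecidablePred p] {a : α} {b : β} (hab : a ∈ A ∧ b ∈ B) (hp : p (a, b)) :
    Real.log ((A ×ˢ B).filter p).card ≤ Real.log A.card + Real.log B.card := by
  have hA : (0 : ℝ) < A.card := by exact_mod_cast Finset.card_pos.2 ⟨a, hab.1⟩
  have hB : (0 : ℝ) < B.card := by exact_mod_cast Finset.card_pos.2 ⟨b, hab.2⟩
  have h0 : 0 < ((A ×ˢ B).filter p).card :=
    Finset.card_pos.2 ⟨(a, b), Finset.mem_filter.2 ⟨Finset.mem_product.2 hab, hp⟩⟩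
  have h1 : ((A ×ˢ B).filter p).card ≤ A.card * B.card :=
    (Finset.card_filter_le _ _).trans (Finset.card_product _ _).le
  rw [← Real.log_mul hA.ne' hB.ne']
  exact Real.log_le_log (by exact_mod_cast h0) (by exact_mod_cast h1)

/-- The Rademacher average of a class of VC dimension `d ≥ 1` on `n` points is `O(√(d n))`. -/
theorem expect_sign_traces_le {X : Type u} {F : Set (X → Bool)} {d n : ℕ} (hd : 1 ≤ d)
    (hF : VCLe F d) (z : Fin n → X) (c : (Fin n → Bool) → Fin n → Bool)
    (hc : ∀ ε, c ε ∈ traces F z) :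
    𝔼 ε : Fin n → Bool, ∑ i, sgn (ε i) * val (c ε i) ≤ 37 * √(d * n) := by
  classical
  have hd' : (1 : ℝ) ≤ d := by exact_mod_cast hd
  rcases Nat.eq_zero_or_pos n with rfl | hn
  · simp
  have hn' : (0 : ℝ) < n := by exact_mod_cast hn
  set A : Finset (Fin n → Bool) := Finset.univ.filter fun b => b ∈ traces F z with hAdef
  have hA : ↑A ⊆ traces F z := fun b hb => (Finset.mem_filter.1 hb).2
  have hcA : ∀ ε, c ε ∈ A := fun ε => Finset.mem_filter.2 ⟨Finset.mem_univ _, hc ε⟩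
  have hnets := fun k : ℕ => exists_net ((16 : ℝ)⁻¹ ^ k * n) (by positivity) A
  choose B hBA hsep hnet using hnets
  choose! π hπB hπ using hnet
  have hcard : ∀ k, Real.log (B k).card ≤ 8 * d * 4 ^ k := fun k =>
    log_card_separated_le hd hF z (B k) ((Finset.coe_subset.2 (hBA k)).trans hA) k (hsep k)
  set S := √((d : ℝ) * n) with hS
  set q := √((d : ℝ) / n) with hq
  have hq0 : 0 < q := by positivity
  have hqS1 : (d : ℝ) / q = S := by
    rw [hq, hS, div_eq_iff (by positivity), ← Real.sqrt_mul (by positivity)]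
    rw [show (d : ℝ) * n * (d / n) = d * d by field_simp, Real.sqrt_mul_self (by positivity)]
  have hqS2 : q * n = S := by
    rw [← hqS1, eq_div_iff hq0.ne']
    have : q * q = d / n := Real.mul_self_sqrt (by positivity)
    rw [mul_right_comm, this]; field_simp
  -- The choice λ = q 8^k makes both terms of Massart's bound proportional to S 2^{-k}. A link of
  -- the chain joins nets of levels k and k - 1, so its logarithmic count is at most (8 + 2) d 4^k
  -- and its squared length at most (1 + 16) n 16^{-k}.
  have hlev : ∀ (k : ℕ) {L R : ℝ}, L ≤ 10 * d * 4 ^ k → R ≤ 17 * n * (16 : ℝ)⁻¹ ^ k →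
      L / (q * 8 ^ k) + q * 8 ^ k * R / 2 ≤ 37 / 2 * S * (2 : ℝ)⁻¹ ^ k := by
    intro k L R hL hR
    have h8 : (8 : ℝ) ^ k = 4 ^ k * 2 ^ k := by rw [← mul_pow]; norm_num
    have h1 : L / (q * 8 ^ k) ≤ 10 * S * (2 : ℝ)⁻¹ ^ k := by
      calc L / (q * 8 ^ k) ≤ (10 * d * 4 ^ k) / (q * 8 ^ k) := by gcongr
        _ = 10 * (d / q) * (2 : ℝ)⁻¹ ^ k := by rw [h8, inv_pow]; field_simp
        _ = _ := by rw [hqS1]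
    have h2 : q * 8 ^ k * R / 2 ≤ 17 / 2 * S * (2 : ℝ)⁻¹ ^ k := by
      calc q * 8 ^ k * R / 2 ≤ q * 8 ^ k * (17 * n * (16 : ℝ)⁻¹ ^ k) / 2 := by gcongr
        _ = 17 / 2 * (q * n) * (8 ^ k * (16 : ℝ)⁻¹ ^ k) := by ring
        _ = _ := by rw [hqS2, ← mul_pow]; norm_num
    linarith
  have hind : ∀ K : ℕ, 𝔼 ε : Fin n → Bool, ∑ i, sgn (ε i) * val (π K (c ε) i)
      ≤ 37 * S * (1 - (2 : ℝ)⁻¹ ^ (K + 1)) := by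
    intro K
    induction K with
    | zero =>
      have h1 := expect_sign_le (B 0) (fun b i => val (b i)) (R := n) (lam := q * 8 ^ 0)
        (by positivity) (fun b _ => by
          calc ∑ i, val (b i) ^ 2 ≤ ∑ _i : Fin n, (1 : ℝ) := Finset.sum_le_sum fun i _ => by
                cases b i <;> simp [val]
            _ = n := by simp) (fun ε => π 0 (c ε)) (fun ε => hπB 0 _ (hcA ε))
      refine h1.trans ((hlev 0 ((hcard 0).trans (by linarith)) (by simp; linarith)).trans ?_)
      norm_num
      linarith
    | succ K ih =>
      have hcl : ∀ ε, (hammingDist (π (K + 1) (c ε)) (π K (c ε)) : ℝ)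
          ≤ 17 * n * (16 : ℝ)⁻¹ ^ (K + 1) := by
        intro ε
        have h1 := hπ (K + 1) _ (hcA ε)
        have h2 := hπ K _ (hcA ε)
        have h3 : (hammingDist (π (K + 1) (c ε)) (π K (c ε)) : ℝ)
            ≤ hammingDist (c ε) (π (K + 1) (c ε)) + hammingDist (c ε) (π K (c ε)) := by
          exact_mod_cast (hammingDist_triangle_right _ _ (c ε)).trans
            (by rw [hammingDist_comm _ (c ε), hammingDist_comm _ (c ε)])
        rw [pow_succ] at h1 ⊢
        linarith
      have h1 := expect_sign_le
        ((B (K + 1) ×ˢ B K).filter fun p =>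
          (hammingDist p.1 p.2 : ℝ) ≤ 17 * n * (16 : ℝ)⁻¹ ^ (K + 1))
        (fun p i => val (p.1 i) - val (p.2 i)) (R := 17 * n * (16 : ℝ)⁻¹ ^ (K + 1))
        (lam := q * 8 ^ (K + 1)) (by positivity)
        (fun p hp => by rw [sum_sq_val_sub]; exact (Finset.mem_filter.1 hp).2)
        (fun ε => (π (K + 1) (c ε), π K (c ε)))
        (fun ε => Finset.mem_filter.2 ⟨Finset.mem_product.2
          ⟨hπB _ _ (hcA ε), hπB _ _ (hcA ε)⟩, hcl ε⟩)
      have hlog := log_card_filter_product_le (B (K + 1)) (B K) (fun p =>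
          (hammingDist p.1 p.2 : ℝ) ≤ 17 * n * (16 : ℝ)⁻¹ ^ (K + 1))
          ⟨hπB _ _ (hcA fun _ => true), hπB _ _ (hcA fun _ => true)⟩ (hcl fun _ => true)
      have hlog' : Real.log (B (K + 1)).card + Real.log (B K).card ≤ 10 * d * 4 ^ (K + 1) := by
        have h2 := hcard (K + 1)
        have h3 := hcard K
        rw [pow_succ] at h2 ⊢
        linarith
      have h2 := h1.trans (hlev (K + 1) (hlog.trans hlog') le_rfl)
      have h3 : 𝔼 ε : Fin n → Bool, ∑ i, sgn (ε i) * val (π (K + 1) (c ε) i)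
          = 𝔼 ε : Fin n → Bool, ∑ i, sgn (ε i) * (val (π (K + 1) (c ε) i) - val (π K (c ε) i))
            + 𝔼 ε : Fin n → Bool, ∑ i, sgn (ε i) * val (π K (c ε) i) := by
        rw [← Finset.expect_add_distrib]
        refine Finset.expect_congr rfl fun ε _ => ?_
        rw [← Finset.sum_add_distrib]
        exact Finset.sum_congr rfl fun i _ => by ring
      rw [h3]
      refine (add_le_add h2 ih).trans (le_of_eq ?_)
      ring
  -- Once the net is finer than one coordinate, a trace coincides with its net point and the chain
  -- may stop.
  obtain ⟨K, hK⟩ : ∃ K : ℕ, (16 : ℝ)⁻¹ ^ K < 1 / n :=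
    exists_pow_lt_of_lt_one (by positivity) (by norm_num)
  have hπK : ∀ ε, π K (c ε) = c ε := by
    intro ε
    have h1 := hπ K _ (hcA ε)
    have h2 : (16 : ℝ)⁻¹ ^ K * n < 1 := (lt_div_iff₀ hn').1 hK
    have h3 : hammingDist (c ε) (π K (c ε)) < 1 := by exact_mod_cast h1.trans h2
    exact (hammingDist_eq_zero.1 (Nat.lt_one_iff.1 h3)).symm
  have h := hind K
  simp_rw [hπK] at h
  refine h.trans ?_
  have : 0 ≤ S * (2 : ℝ)⁻¹ ^ (K + 1) := by positivity
  linarith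

end HybridLearning

namespace HybridLearning

noncomputable section

/-! ### Suprema over classes that depend only on the traces -/

section Traces

variable {X : Type u} {ι : Type} [Finite ι] (F : Set (X → Bool)) (φ : (ι → Bool) → ℝ) (z : ι → X)

theorem finite_range_comp :
    (Set.range fun f : F => φ fun i => f.1 (z i)).Finite :=
  (Set.finite_range φ).subset (by rintro _ ⟨f, rfl⟩; exact ⟨_, rfl⟩)

theorem le_iSup_comp {f : X → Bool} (hf : f ∈ F) :
    φ (fun i => f (z i)) ≤ ⨆ f : F, φ fun i => f.1 (z i) :=
  le_ciSup (finite_range_comp F φ z).bddAbove (⟨f, hf⟩ : F)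

theorem iInf_comp_le {f : X → Bool} (hf : f ∈ F) :
    ⨅ f : F, φ (fun i => f.1 (z i)) ≤ φ fun i => f (z i) :=
  ciInf_le (finite_range_comp F φ z).bddBelow (⟨f, hf⟩ : F)

variable {F}

theorem exists_eq_iSup_comp (hF : F.Nonempty) :
    ∃ f ∈ F, ⨆ f : F, φ (fun i => f.1 (z i)) = φ fun i => f (z i) := by
  have := hF.to_subtype
  obtain ⟨f, hf⟩ := (Set.range_nonempty fun f : F => φ fun i => f.1 (z i)).csSup_mem
    (finite_range_comp F φ z)
  exact ⟨f.1, f.2, hf.symm⟩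

theorem exists_eq_iInf_comp (hF : F.Nonempty) :
    ∃ f ∈ F, ⨅ f : F, φ (fun i => f.1 (z i)) = φ fun i => f (z i) := by
  have := hF.to_subtype
  obtain ⟨f, hf⟩ := (Set.range_nonempty fun f : F => φ fun i => f.1 (z i)).csInf_mem
    (finite_range_comp F φ z)
  exact ⟨f.1, f.2, hf.symm⟩

end Traces

/-- No boundedness is needed: the real infimum is defined by this reflection, default values
included. -/
theorem iInf_eq_neg_iSup_neg {ι : Sort*} (f : ι → ℝ) : ⨅ i, f i = -⨆ i, -f i := by
  rw [iInf, iSup, Real.sInf_def]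
  congr 2
  ext x
  simp only [Set.mem_neg, Set.mem_range]
  exact exists_congr fun y => ⟨fun h => by rw [h, neg_neg], fun h => by rw [← h, neg_neg]⟩

/-! ### Measurability through traces. -/

/-- For every finite family of points, the set of traces is a measurable function of the points. -/
def MeasurableTraces {X : Type u} [MeasurableSpace X] (F : Set (X → Bool)) : Prop :=
  ∀ (ι : Type) [Finite ι], Measurable fun z : ι → X => traces F z

theorem measurableTraces_of_fin {X : Type u} [MeasurableSpace X] {F : Set (X → Bool)}
    (h : ∀ (n : ℕ) (b : Fin n → Bool), MeasurableSet {z : Fin n → X | b ∈ traces F z}) :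
    MeasurableTraces F := by
  intro ι _
  obtain ⟨n, ⟨e⟩⟩ := Finite.exists_equiv_fin ι
  refine measurable_set_iff.2 fun b => measurableSet_setOfPred.1 ?_
  have h1 : Measurable fun z : ι → X => z ∘ e.symm :=
    measurable_pi_iff.2 fun i => measurable_pi_apply _
  convert h1 (h n (b ∘ e.symm)) using 1
  ext z
  simp only [Set.mem_ofPred_eq, Set.mem_preimage, traces, Function.comp]
  refine exists_congr fun f => and_congr_right fun _ => ?_
  exact ⟨fun h i => h _, fun h i => by simpa using h (e i)⟩

/-- The supremum factors through the set of traces, which takes values in a finite space where every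
function is measurable. -/
theorem MeasurableTraces.iSup {X : Type u} [MeasurableSpace X] {F : Set (X → Bool)}
    (hF : MeasurableTraces F) {ι : Type} [Finite ι] (φ : (ι → Bool) → ℝ) :
    Measurable fun z : ι → X => ⨆ f : F, φ fun i => f.1 (z i) := by
  have h1 : Measurable fun S : Set (ι → Bool) => sSup (φ '' S) := measurable_of_countable _
  convert h1.comp (hF ι) using 1
  funext z
  refine congrArg sSup (Set.ext fun r => ?_)
  constructor
  · rintro ⟨f, rfl⟩
    exact ⟨_, ⟨f.1, f.2, fun i => rfl⟩, rfl⟩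
  · rintro ⟨b, ⟨f, hf, hfb⟩, rfl⟩
    refine ⟨⟨f, hf⟩, ?_⟩
    simp only
    congr 1
    funext i
    exact hfb i

theorem MeasurableTraces.iInf {X : Type u} [MeasurableSpace X] {F : Set (X → Bool)}
    (hF : MeasurableTraces F) {ι : Type} [Finite ι] (φ : (ι → Bool) → ℝ) :
    Measurable fun z : ι → X => ⨅ f : F, φ fun i => f.1 (z i) := by
  simp_rw [iInf_eq_neg_iSup_neg]
  exact (hF.iSup fun b => -φ b).neg

/-- A labelling `b` is a trace of `H` exactly when the best loss against the labels `b` vanishes,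
since the infimum is attained. -/
theorem MeasurableClass.measurableTraces {X : Type u} [MeasurableSpace X] {H : Set (X → Bool)}
    (hH : MeasurableClass H) : MeasurableTraces H := by
  refine measurableTraces_of_fin fun n b => ?_
  rcases H.eq_empty_or_nonempty with rfl | hne
  · simp [traces]
  have key : {z : Fin n → X | b ∈ traces H z}
      = {z | bestLoss H z (fun i => if b i then 1 else 0) = 0} := by
    ext z
    have hnn : ∀ (c : Bool) (b : Bool), 0 ≤ |val c - ((if b then 1 else 0 : I) : ℝ)| :=
      fun _ _ => abs_nonneg _
    simp only [Set.mem_ofPred_eq, bestLoss]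
    constructor
    · rintro ⟨f, hf, hfb⟩
      refine le_antisymm ?_ (Real.iInf_nonneg fun h => Finset.sum_nonneg fun i _ => hnn _ _)
      refine (iInf_comp_le H (fun c : Fin n → Bool =>
        ∑ i, |val (c i) - ((if b i then 1 else 0 : I) : ℝ)|) z hf).trans (le_of_eq ?_)
      refine Finset.sum_eq_zero fun i _ => ?_
      simp only [hfb i]
      cases b i <;> simp [val]
    · intro h0
      obtain ⟨f, hf, hfeq⟩ := exists_eq_iInf_comp (fun c : Fin n → Bool =>
        ∑ i, |val (c i) - ((if b i then 1 else 0 : I) : ℝ)|) z hne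
      refine ⟨f, hf, fun i => ?_⟩
      rw [h0, eq_comm, Finset.sum_eq_zero_iff_of_nonneg fun i _ => hnn _ _] at hfeq
      have := hfeq i (Finset.mem_univ _)
      revert this
      cases f (z i) <;> cases b i <;> simp [val]
  rw [key]
  exact (hH n _) (measurableSet_singleton 0)

theorem iSup_mem_eq_true {X : Type u} (H' : Set (X → Bool)) (x : X) :
    (⨆ h ∈ H', h x) = true ↔ ∃ h ∈ H', h x = true := by
  constructor
  · intro h
    by_contra! hcon
    have : (⨆ h ∈ H', h x) ≤ false := iSup₂_le fun f hf => by simp [hcon f hf]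
    rw [h] at this
    exact absurd this (by decide)
  · rintro ⟨f, hf, hfx⟩
    have := le_iSup₂ (f := fun (h : X → Bool) (_ : h ∈ H') => h x) f hf
    rw [hfx] at this
    exact top_le_iff.1 this

theorem iInf_mem_eq_true {X : Type u} (H' : Set (X → Bool)) (x : X) :
    (⨅ h ∈ H', h x) = true ↔ ∀ h ∈ H', h x = true := by
  constructor
  · intro h f hf
    have := iInf₂_le (f := fun (h : X → Bool) (_ : h ∈ H') => h x) f hf
    rw [h] at this
    exact top_le_iff.1 this
  · intro h
    exact top_le_iff.1 (le_iInf₂ fun f hf => (h f hf).ge)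

theorem subset_supClass {X : Type u} (H : Set (X → Bool)) : H ⊆ supClass H := by
  intro h hh
  exact ⟨{h}, by simpa using hh, by simp⟩

/-- If `b` is the trace of some supremum, it is that of the largest admissible subfamily, all
members lying below `b` on the points. Hence the traces of `supClass H` are determined by those of
`H`, and measurability carries over. -/
theorem mem_traces_supClass {X ι : Type*} (H : Set (X → Bool)) (z : ι → X) (b : ι → Bool) :
    b ∈ traces (supClass H) z ↔
      ∀ i, b i = true → ∃ c ∈ traces H z, c i = true ∧ ∀ j, c j = true → b j = true := by
  constructor
  · rintro ⟨_, ⟨H', hH', rfl⟩, hb⟩ i hi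
    rw [← hb i, iSup_mem_eq_true] at hi
    obtain ⟨h, hh, hhi⟩ := hi
    refine ⟨fun j => h (z j), ⟨h, hH' hh, fun _ => rfl⟩, hhi, fun j hj => ?_⟩
    rw [← hb j, iSup_mem_eq_true]
    exact ⟨h, hh, hj⟩
  · intro hb
    refine ⟨_, ⟨{h ∈ H | ∀ j, h (z j) = true → b j = true}, Set.sep_subset _ _, rfl⟩, fun i => ?_⟩
    rw [Bool.eq_iff_iff, iSup_mem_eq_true]
    constructor
    · rintro ⟨h, hh, hi⟩
      exact hh.2 i hi
    · intro hi
      obtain ⟨c, ⟨h, hh, hhc⟩, hci, hcb⟩ := hb i hi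
      exact ⟨h, ⟨hh, fun j hj => hcb j (by rw [← hhc j]; exact hj)⟩, by rw [hhc i]; exact hci⟩

theorem MeasurableTraces.supClass {X : Type u} [MeasurableSpace X] {H : Set (X → Bool)}
    (hH : MeasurableTraces H) : MeasurableTraces (supClass H) := by
  intro ι _
  have h1 : Measurable fun S : Set (ι → Bool) => {b : ι → Bool |
    ∀ i, b i = true → ∃ c ∈ S, c i = true ∧ ∀ j, c j = true → b j = true} :=
    measurable_of_countable _
  convert h1.comp (hH ι) using 1
  funext z
  ext b
  exact mem_traces_supClass H z b

/-- The class of the complements of the members of `H`. -/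
def complClass {X : Type u} (H : Set (X → Bool)) : Set (X → Bool) := (fun h x => !(h x)) '' H

theorem MeasurableTraces.complClass {X : Type u} [MeasurableSpace X] {H : Set (X → Bool)}
    (hH : MeasurableTraces H) : MeasurableTraces (complClass H) := by
  intro ι _
  have h1 : Measurable fun S : Set (ι → Bool) => {b : ι → Bool | (fun i => !(b i)) ∈ S} :=
    measurable_of_countable _
  convert h1.comp (hH ι) using 1
  funext z
  ext b
  simp only [traces, HybridLearning.complClass, Set.mem_ofPred_eq, Function.comp, Set.exists_mem_image]
  exact exists_congr fun h => and_congr_right fun _ => forall_congr' fun i => by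
    cases h (z i) <;> cases b i <;> simp

/-- De Morgan: suprema of complements are the complements of infima, and complementing labellings
preserves shattering. -/
theorem VCLe.supClass_complClass {X : Type u} {H : Set (X → Bool)} {d : ℕ} (h : VCLe (infClass H) d) :
    VCLe (supClass (complClass H)) d := by
  intro s hs
  refine h s fun b => ?_
  obtain ⟨_, ⟨H', hH', rfl⟩, hf⟩ := hs fun x => !(b x)
  refine ⟨_, ⟨{h ∈ H | (fun x => !(h x)) ∈ H'}, Set.sep_subset _ _, rfl⟩, fun x hx => ?_⟩
  have := hf x hx
  rw [Bool.eq_iff_iff, iSup_mem_eq_true] at this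
  rw [Bool.eq_iff_iff, iInf_mem_eq_true]
  have h2 : b x = true ↔ ¬ (!(b x)) = true := by simp
  rw [h2, ← this]
  push Not
  constructor
  · intro h3 k hk
    obtain ⟨g, hg, rfl⟩ := hH' hk
    simpa using h3 g ⟨hg, hk⟩
  · rintro h3 g ⟨_, hg⟩
    simpa using h3 _ hg

theorem VCLe.of_vcDim_le {X : Type u} {F : Set (X → Bool)} {d : ℕ} (h : vcDim F ≤ d) :
    VCLe F d := by
  intro s hs
  have h1 : (s.card : ℕ∞) ≤ vcDim F :=
    le_iSup (fun s : {s : Finset X // Shatters F s} => (s.1.card : ℕ∞)) ⟨s, hs⟩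
  exact_mod_cast h1.trans h

/-! ### Uniform deviations over pointwise suprema -/

/-- The difference between the numbers of ones on the right and on the left. -/
def diffSum {M : ℕ} (b : Fin M ⊕ Fin M → Bool) : ℝ :=
  ∑ i, (val (b (.inr i)) - val (b (.inl i)))

/-- The largest difference between the numbers of points of the samples `z` and `w` that lie in a
member of `supClass F`. -/
def gap {X : Type u} (F : Set (X → Bool)) {M : ℕ} (w z : Fin M → X) : ℝ :=
  ⨆ f : supClass F, diffSum fun i => f.1 (Sum.elim w z i)

/-- The expectation of `gap F w z` over a random sample `z`. -/
def meanGap {X : Type u} [MeasurableSpace X] (μ : Measure X) (F : Set (X → Bool)) {M : ℕ}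
    (w : Fin M → X) : ℝ :=
  ∫ z, gap F w z ∂(Measure.pi fun _ => μ)

theorem supClass_nonempty {X : Type u} (H : Set (X → Bool)) : (supClass H).Nonempty :=
  ⟨_, ∅, Set.empty_subset _, rfl⟩

theorem abs_gap_le {X : Type u} (F : Set (X → Bool)) {M : ℕ} (w z : Fin M → X) :
    |gap F w z| ≤ M := by
  obtain ⟨f, -, hf⟩ := exists_eq_iSup_comp (F := supClass F) diffSum (Sum.elim w z) (supClass_nonempty F)
  have : gap F w z = ∑ i, (val (f (z i)) - val (f (w i))) := by
    rw [gap, hf]; rfl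
  rw [this]
  refine (Finset.abs_sum_le_sum_abs _ _).trans ?_
  calc _ ≤ ∑ _i : Fin M, (1 : ℝ) := Finset.sum_le_sum fun i _ => by
        cases f (z i) <;> cases f (w i) <;> simp [val]
    _ = M := by simp

theorem MeasurableTraces.measurable_gap {X : Type u} [MeasurableSpace X] {F : Set (X → Bool)}
    (hF : MeasurableTraces F) (M : ℕ) :
    Measurable fun p : (Fin M → X) × (Fin M → X) => gap F p.1 p.2 := by
  have h1 := hF.supClass.iSup (diffSum (M := M))
  have h2 : Measurable fun p : (Fin M → X) × (Fin M → X) => (Sum.elim p.1 p.2 : Fin M ⊕ Fin M → X) := by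
    refine measurable_pi_iff.2 fun i => ?_
    cases i
    · exact (measurable_pi_apply _).comp measurable_fst
    · exact (measurable_pi_apply _).comp measurable_snd
  simpa only [Function.comp_def, gap] using h1.comp h2

theorem integrable_of_bdd {α : Type*} [MeasurableSpace α] {μ : Measure α} [IsFiniteMeasure μ]
    {f : α → ℝ} (hf : Measurable f) {C : ℝ} (hC : ∀ a, |f a| ≤ C) : Integrable f μ :=
  Integrable.of_bound hf.aestronglyMeasurable C (Filter.Eventually.of_forall hC)

/-- Differences of functions `x ↦ sup_h (h(x) + g(h))` are dominated by those of members of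
`supClass F`, by integrating over level sets. -/
theorem sum_iSup_sub_le_gap {X : Type u} {M : ℕ} {F : Set (X → Bool)} (hF : F.Nonempty) (g : F → ℝ)
    (hg : (Set.range g).Finite) (w z : Fin M → X) :
    ∑ i, ((⨆ h : F, (val (h.1 (z i)) + g h)) - ⨆ h : F, (val (h.1 (w i)) + g h)) ≤ gap F w z := by
  have := hF.to_subtype
  set m := ⨆ h, g h with hm
  have hgm : ∀ h, g h ≤ m := le_ciSup hg.bddAbove
  obtain ⟨B, hB⟩ := hg.bddAbove
  have hbdd : ∀ x, BddAbove (Set.range fun h : F => val (h.1 x) + g h) := by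
    refine fun x => ⟨1 + B, ?_⟩
    rintro _ ⟨h, rfl⟩
    exact add_le_add (val_le_one _) (hB ⟨h, rfl⟩)
  set v : X → ℝ := fun x => (⨆ h : F, (val (h.1 x) + g h)) - m with hv
  have hv0 : ∀ x, 0 ≤ v x := by
    intro x
    refine sub_nonneg.2 (ciSup_le fun h => ?_)
    exact (le_add_of_nonneg_left (val_nonneg _)).trans (le_ciSup (hbdd x) h)
  have hv1 : ∀ x, v x ≤ 1 := by
    intro x
    refine sub_le_iff_le_add.2 (ciSup_le fun h => add_le_add (val_le_one _) (hgm h))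
  -- For s ≥ 0 an `h` with h(x) = 0 is irrelevant to whether v x > s, because g h - m ≤ 0. So the
  -- superlevel set of `v` is the union of those members of `F` with 1 + g h - m > s.
  set f : ℝ → X → Bool := fun s x => ⨆ h ∈ {h : X → Bool | ∃ hh : h ∈ F, s < 1 + g ⟨h, hh⟩ - m}, h x
    with hf
  have hfF : ∀ s, f s ∈ supClass F := fun s => ⟨_, fun h hh => hh.1, rfl⟩
  have hfv : ∀ s, 0 ≤ s → ∀ x, val (f s x) = (Set.Iio (v x)).indicator (fun _ => (1 : ℝ)) s := by
    intro s hs x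
    have h1 : f s x = true ↔ s < v x := by
      rw [hf, iSup_mem_eq_true, hv, lt_sub_iff_add_lt, lt_ciSup_iff (hbdd x)]
      constructor
      · rintro ⟨h, ⟨hh, h2⟩, h3⟩
        refine ⟨⟨h, hh⟩, ?_⟩
        simp only [h3, val, if_true]
        linarith
      · rintro ⟨⟨h, hh⟩, h2⟩
        have h3 : h x = true := by
          by_contra h4
          have h5 := hgm ⟨h, hh⟩
          simp only [val, h4] at h2
          norm_num at h2
          linarith
        refine ⟨h, ⟨hh, ?_⟩, h3⟩
        simp only [h3, val, if_true] at h2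
        linarith
    by_cases h2 : s < v x
    · rw [Set.indicator_of_mem (Set.mem_Iio.2 h2), val, if_pos (h1.2 h2)]
    · rw [Set.indicator_of_notMem (by simpa using h2), val, if_neg (by rwa [h1])]
  have hint : ∀ x, IntegrableOn ((Set.Iio (v x)).indicator fun _ => (1 : ℝ)) (Set.Ioo 0 1) :=
    fun x => (integrable_const _).indicator measurableSet_Iio
  have hval : ∀ x, ∫ s in Set.Ioo (0 : ℝ) 1, (Set.Iio (v x)).indicator (fun _ => (1 : ℝ)) s = v x := by
    intro x
    rw [setIntegral_indicator measurableSet_Iio, setIntegral_const]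
    have : Set.Ioo (0 : ℝ) 1 ∩ Set.Iio (v x) = Set.Ioo 0 (v x) := by
      ext s
      simp only [Set.mem_inter_iff, Set.mem_Ioo, Set.mem_Iio]
      exact ⟨fun h => ⟨h.1.1, h.2⟩, fun h => ⟨⟨h.1, h.2.trans_le (hv1 x)⟩, h.2⟩⟩
    rw [this]
    simp [hv0 x]
  calc _ = ∑ i, (v (z i) - v (w i)) := Finset.sum_congr rfl fun i _ => by simp only [hv]; ring
    _ = ∫ s in Set.Ioo (0 : ℝ) 1, ∑ i, ((Set.Iio (v (z i))).indicator (fun _ => (1 : ℝ)) s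
          - (Set.Iio (v (w i))).indicator (fun _ => (1 : ℝ)) s) := by
        have hsub : ∀ i, IntegrableOn (fun s => (Set.Iio (v (z i))).indicator (fun _ => (1 : ℝ)) s
          - (Set.Iio (v (w i))).indicator (fun _ => (1 : ℝ)) s) (Set.Ioo 0 1) :=
          fun i => (hint _).sub (hint _)
        rw [integral_finsetSum _ fun i _ => hsub i]
        refine Finset.sum_congr rfl fun i _ => ?_
        rw [integral_sub (hint _) (hint _), hval, hval]
    _ ≤ ∫ _s in Set.Ioo (0 : ℝ) 1, gap F w z := by
        refine setIntegral_mono_on (integrable_finsetSum _ fun i _ => (hint _).sub (hint _))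
          (integrable_const _) measurableSet_Ioo fun s hs => ?_
        simp_rw [← hfv s hs.1.le]
        exact le_iSup_comp (supClass F) diffSum (Sum.elim w z) (hfF s)
    _ = gap F w z := by simp

section

variable {X : Type u} [MeasurableSpace X] {μ : Measure X} [IsProbabilityMeasure μ]
  {F : Set (X → Bool)} {M : ℕ}

theorem MeasurableTraces.measurable_meanGap (hF : MeasurableTraces F) :
    Measurable fun w : Fin M → X => meanGap μ F w :=
  ((hF.measurable_gap M).stronglyMeasurable.integral_prod_right').measurable

theorem abs_meanGap_le (w : Fin M → X) : |meanGap μ F w| ≤ M := by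
  have := norm_integral_le_of_norm_le_const (μ := Measure.pi fun _ : Fin M => μ)
    (f := fun z => gap F w z) (C := M) (Filter.Eventually.of_forall fun z => abs_gap_le F w z)
  simpa [meanGap] using this

/-- Symmetrisation. -/
theorem integral_meanGap_le (hF : MeasurableTraces F) {d : ℕ} (hd : 1 ≤ d)
    (hvc : VCLe (supClass F) d) :
    ∫ w, meanGap μ F w ∂(Measure.pi fun _ : Fin M => μ) ≤ 74 * √(d * M) := by
  classical
  set π := Measure.pi fun _ : Fin M => μ with hπ
  set ρ := Measure.pi fun _ : Fin M => μ.prod μ with hρ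
  set S : (Fin M → X × X) → ℝ := fun a => gap F (fun i => (a i).1) (fun i => (a i).2) with hS
  have hmeas := hF.measurable_gap M
  have hSm : Measurable S := by
    have h0 : Measurable fun a : Fin M → X × X => ((fun i => (a i).1, fun i => (a i).2) :
        (Fin M → X) × (Fin M → X)) :=
      (measurable_pi_iff.2 fun i => measurable_fst.comp (measurable_pi_apply i)).prodMk
        (measurable_pi_iff.2 fun i => measurable_snd.comp (measurable_pi_apply i))
    have h1 := hmeas.comp h0
    rwa [Function.comp_def] at h1
  have hSb : ∀ a, |S a| ≤ M := fun a => abs_gap_le F _ _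
  have h1 : ∫ w, meanGap μ F w ∂π = ∫ a, S a ∂ρ := by
    have h5 := (measurePreserving_arrowProdEquivProdArrow X X (Fin M) (fun _ => μ)
      (fun _ => μ)).integral_comp' fun p : (Fin M → X) × (Fin M → X) => gap F p.1 p.2
    have h6 := integral_prod (μ := π) (ν := π)
      (fun p : (Fin M → X) × (Fin M → X) => gap F p.1 p.2)
      (integrable_of_bdd (C := M) hmeas fun p => abs_gap_le F _ _)
    exact h6.symm.trans h5.symm
  -- Exchanging the two points of a pair preserves the law, so `S` may be averaged over all patterns
  -- of exchanges; this produces the random signs.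
  set sw : (Fin M → Bool) → (Fin M → X × X) → Fin M → X × X :=
    fun ε a i => if ε i then a i else (a i).swap with hsw
  have hswp : ∀ ε, MeasurePreserving (sw ε) ρ ρ := by
    intro ε
    refine measurePreserving_pi (fun _ => μ.prod μ) (fun _ => μ.prod μ)
      (f := fun i p => if ε i then p else p.swap) fun i => ?_
    cases ε i
    · exact Measure.measurePreserving_swap
    · exact MeasurePreserving.id (μ.prod μ)
  have h2 : ∀ ε, ∫ a, S (sw ε a) ∂ρ = ∫ a, S a ∂ρ := by
    intro ε
    rw [← (hswp ε).map_eq, integral_map (hswp ε).measurable.aemeasurable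
      hSm.aestronglyMeasurable, (hswp ε).map_eq]
  have hSi : ∀ ε, Integrable (fun a => S (sw ε a)) ρ := fun ε =>
    integrable_of_bdd (hSm.comp (hswp ε).measurable) fun a => hSb _
  have h3 : ∫ a, S a ∂ρ = ∫ a, 𝔼 ε : Fin M → Bool, S (sw ε a) ∂ρ := by
    simp_rw [Fintype.expect_eq_sum_div_card]
    rw [integral_div, integral_finsetSum _ fun ε _ => hSi ε]
    simp_rw [h2]
    simp
  rw [h1, h3]
  -- For fixed points the maximiser depends on the signs only, and the sum splits into a Rademacher
  -- average over each sample: 74 = 2 · 37.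
  have h4 : ∀ a : Fin M → X × X, 𝔼 ε : Fin M → Bool, S (sw ε a) ≤ 74 * √(d * M) := by
    intro a
    have h5 : ∀ ε : Fin M → Bool, ∃ f ∈ supClass F, S (sw ε a)
        = ∑ i, sgn (ε i) * val (f (a i).2) + ∑ i, sgn (!(ε i)) * val (f (a i).1) := by
      intro ε
      obtain ⟨f, hf, hfe⟩ := exists_eq_iSup_comp (F := supClass F)
        diffSum
        (Sum.elim (fun i => (sw ε a i).1) (fun i => (sw ε a i).2)) (supClass_nonempty F)
      refine ⟨f, hf, ?_⟩
      have h6 : S (sw ε a) = ∑ i, (val (f (sw ε a i).2) - val (f (sw ε a i).1)) := by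
        simp only [hS, gap]
        rw [hfe]; rfl
      rw [h6, ← Finset.sum_add_distrib]
      refine Finset.sum_congr rfl fun i _ => ?_
      simp only [hsw]
      cases ε i <;> simp [sgn] <;> ring
    choose f hf hfe using h5
    simp_rw [hfe]
    rw [Finset.expect_add_distrib]
    have h7 := expect_sign_traces_le hd hvc (fun i => (a i).2) (fun ε i => f ε (a i).2)
      (fun ε => ⟨f ε, hf ε, fun i => rfl⟩)
    have h8 := expect_sign_traces_le hd hvc (fun i => (a i).1)
      (fun ε i => f (fun i => !(ε i)) (a i).1) (fun ε => ⟨_, hf _, fun i => rfl⟩)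
    have h9 : 𝔼 ε : Fin M → Bool, ∑ i, sgn (!(ε i)) * val (f ε (a i).1)
        = 𝔼 ε : Fin M → Bool, ∑ i, sgn (ε i) * val (f (fun i => !(ε i)) (a i).1) := by
      refine Fintype.expect_equiv (Equiv.arrowCongr (Equiv.refl _) Equiv.boolNot) _ _ fun ε => ?_
      refine Finset.sum_congr rfl fun i _ => ?_
      simp [Equiv.arrowCongr, Function.comp_def]
    rw [h9]
    linarith
  calc ∫ a, 𝔼 ε : Fin M → Bool, S (sw ε a) ∂ρ ≤ ∫ _a, 74 * √(d * M) ∂ρ := by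
        refine integral_mono ?_ (integrable_const _) h4
        simp_rw [Fintype.expect_eq_sum_div_card]
        exact Integrable.div_const (integrable_finsetSum _ fun ε _ => hSi ε) _
    _ = _ := by simp

/-- `sum_iSup_sub_le_gap` is integrated over an independent sample `z` with `w` kept fixed. The
error does not involve `g`, so `g` may have been chosen with knowledge of `w`. -/
theorem integral_iSup_le (hF : F.Nonempty) (hFm : MeasurableTraces F) (g : F → ℝ)
    (hg : (Set.range g).Finite)
    (hu : Measurable fun x => ⨆ h : F, (val (h.1 x) + g h)) {C : ℝ}
    (hC : ∀ x, |⨆ h : F, (val (h.1 x) + g h)| ≤ C) (w : Fin M → X) :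
    M * ∫ x, (⨆ h : F, (val (h.1 x) + g h)) ∂μ
      ≤ ∑ i, (⨆ h : F, (val (h.1 (w i)) + g h)) + meanGap μ F w := by
  set U : X → ℝ := fun x => ⨆ h : F, (val (h.1 x) + g h) with hU
  have hUi : Integrable U μ := integrable_of_bdd hu hC
  have hei : ∀ i : Fin M, Integrable (fun z : Fin M → X => U (z i)) (Measure.pi fun _ => μ) :=
    fun i => integrable_of_bdd (hu.comp (measurable_pi_apply i)) fun z => hC _
  have hsub : ∀ i : Fin M, Integrable (fun z : Fin M → X => U (z i) - U (w i))
      (Measure.pi fun _ => μ) := fun i => (hei i).sub (integrable_const _)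
  have h1 : ∫ z : Fin M → X, ∑ i, (U (z i) - U (w i)) ∂(Measure.pi fun _ => μ)
      = M * ∫ x, U x ∂μ - ∑ i, U (w i) := by
    rw [integral_finsetSum _ fun i _ => hsub i]
    have : ∀ i : Fin M, ∫ z : Fin M → X, (U (z i) - U (w i)) ∂(Measure.pi fun _ => μ)
        = ∫ x, U x ∂μ - U (w i) := by
      intro i
      rw [integral_sub (hei i) (integrable_const _),
        integral_comp_eval (μ := fun _ : Fin M => μ) hUi.aestronglyMeasurable]
      simp
    simp_rw [this, Finset.sum_sub_distrib]
    simp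
  have h2 : ∫ z : Fin M → X, ∑ i, (U (z i) - U (w i)) ∂(Measure.pi fun _ => μ) ≤ meanGap μ F w := by
    refine integral_mono (integrable_finsetSum _ fun i _ => hsub i) ?_
      fun z => sum_iSup_sub_le_gap hF g hg w z
    have h3 : Measurable fun z : Fin M → X => gap F w z := by
      have h4 := (hFm.measurable_gap M).comp (measurable_const (a := w).prodMk measurable_id)
      rwa [Function.comp_def] at h4
    exact integrable_of_bdd (C := M) h3 fun z => abs_gap_le F w z
  linarith

end

end

end HybridLearning

namespace HybridLearning

noncomputable section

/-! ### The relaxation -/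

/-- `g` takes finitely many values on `H`. -/
def FiniteOn {X : Type u} (H : Set (X → Bool)) (g : (X → Bool) → ℝ) : Prop :=
  (Set.range fun h : H => g h.1).Finite

section FiniteOn

variable {X : Type u} {H : Set (X → Bool)} {f g : (X → Bool) → ℝ}

theorem FiniteOn.map₂ (hf : FiniteOn H f) (hg : FiniteOn H g) (φ : ℝ → ℝ → ℝ) :
    FiniteOn H fun h => φ (f h) (g h) := by
  refine (Set.Finite.image2 φ hf hg).subset ?_
  rintro _ ⟨h, rfl⟩
  exact ⟨_, ⟨h, rfl⟩, _, ⟨h, rfl⟩, rfl⟩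

theorem FiniteOn.add (hf : FiniteOn H f) (hg : FiniteOn H g) : FiniteOn H fun h => f h + g h :=
  hf.map₂ hg (· + ·)

theorem finiteOn_comp {ι : Type} [Finite ι] (φ : (ι → Bool) → ℝ) (z : ι → X) :
    FiniteOn H fun h => φ fun i => h (z i) :=
  finite_range_comp H φ z

theorem finiteOn_apply (φ : Bool → ℝ) (x : X) : FiniteOn H fun h => φ (h x) :=
  finiteOn_comp (fun b : Unit → Bool => φ (b ())) fun _ => x

theorem FiniteOn.iInf_le (hg : FiniteOn H g) {h : X → Bool} (hh : h ∈ H) : ⨅ h : H, g h.1 ≤ g h :=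
  ciInf_le (Set.Finite.bddBelow hg) (⟨h, hh⟩ : H)

theorem FiniteOn.iInf_add_le (hH : H.Nonempty) (hf : FiniteOn H f) (hg : FiniteOn H g) :
    (⨅ h : H, f h.1) + ⨅ h : H, g h.1 ≤ ⨅ h : H, (f h.1 + g h.1) :=
  have := hH.to_subtype
  le_ciInf fun h => add_le_add (hf.iInf_le h.2) (hg.iInf_le h.2)

theorem FiniteOn.iInf_mono (hH : H.Nonempty) (hf : FiniteOn H f) (hfg : ∀ h, f h ≤ g h) :
    ⨅ h : H, f h.1 ≤ ⨅ h : H, g h.1 :=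
  have := hH.to_subtype
  le_ciInf fun h => (hf.iInf_le h.2).trans (hfg _)

theorem FiniteOn.iInf_add_const (hH : H.Nonempty) (hf : FiniteOn H f) (c : ℝ) :
    ⨅ h : H, (f h.1 + c) = (⨅ h : H, f h.1) + c :=
  have := hH.to_subtype
  (ciInf_add (Set.Finite.bddBelow hf) c).symm

theorem FiniteOn.iInf_const_mul {c : ℝ} (hc : 0 ≤ c) :
    ⨅ h : H, (c * f h.1) = c * ⨅ h : H, f h.1 :=
  (Real.mul_iInf_of_nonneg hc _).symm

end FiniteOn

section

variable {X : Type u} {H : Set (X → Bool)} {M m : ℕ}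

/-- The signed sum of the values of `h` over draws `r` from the sample `w`. -/
def score (w : Fin M → X) (r : Fin m → Bool × Fin M) (h : X → Bool) : ℝ :=
  ∑ j, sgn (r j).1 * val (h (w (r j).2))

/-- The least value of `g` perturbed by `m` random signed draws from the sample `w`, averaged over
the draws. -/
def relax (H : Set (X → Bool)) (w : Fin M → X) (m : ℕ) (g : (X → Bool) → ℝ) : ℝ :=
  𝔼 r : Fin m → Bool × Fin M, ⨅ h : H, (g h.1 + score w r h.1)

theorem finiteOn_score (w : Fin M → X) (r : Fin m → Bool × Fin M) : FiniteOn H (score w r) :=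
  finiteOn_comp (fun b : Fin M → Bool => ∑ j, sgn (r j).1 * val (b (r j).2)) w

theorem relax_zero (w : Fin M → X) (g : (X → Bool) → ℝ) : relax H w 0 g = ⨅ h : H, g h.1 := by
  simp [relax, score]

/-- Isolates one draw, the slot that the signed fresh feature of a round will be compared with. -/
theorem relax_succ (w : Fin M → X) (g : (X → Bool) → ℝ) :
    relax H w (m + 1) g = 𝔼 r : Fin m → Bool × Fin M, 𝔼 p : Bool × Fin M,
      ⨅ h : H, (g h.1 + score w r h.1 + sgn p.1 * val (h.1 (w p.2))) := by
  rw [relax, Finset.expect_comm, ← Finset.expect_product', Finset.univ_product_univ]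
  refine (Fintype.expect_equiv (Fin.snocEquiv fun _ => Bool × Fin M) _ _ fun q => ?_).symm
  simp [score, Fin.sum_univ_castSucc, Fin.snocEquiv, add_assoc]

theorem expect_score [NeZero M] (w : Fin M → X) (h : X → Bool) :
    𝔼 r : Fin m → Bool × Fin M, score w r h = 0 := by
  have h1 : 𝔼 r : Fin m → Bool × Fin M, score w r h = 𝔼 r : Fin m → Bool × Fin M, -score w r h := by
    refine Fintype.expect_equiv
      (Equiv.arrowCongr (Equiv.refl _) (Equiv.prodCongr Equiv.boolNot (Equiv.refl _))) _ _
      fun r => ?_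
    simp [score, Equiv.arrowCongr, sgn_not]
  rw [Finset.expect_neg_distrib] at h1
  linarith

/-- The score has mean zero, and a mean of infima is at most the infimum of means. -/
theorem relax_le_iInf [NeZero M] (hH : H.Nonempty) (w : Fin M → X) {g : (X → Bool) → ℝ}
    (hg : FiniteOn H g) : relax H w m g ≤ ⨅ h : H, g h.1 := by
  have := hH.to_subtype
  refine le_ciInf fun h => ?_
  calc relax H w m g ≤ 𝔼 r : Fin m → Bool × Fin M, (g h.1 + score w r h.1) :=
        Finset.expect_le_expect fun r _ => (hg.add (finiteOn_score w r)).iInf_le h.2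
    _ = g h.1 := by
        rw [Finset.expect_add_distrib, expect_score, Fintype.expect_const, add_zero]

/-- The price of starting a playout. The infimum is superadditive, so only the mean of the least
score matters; for fixed indices this is minus a Rademacher average at the points `w (s j)`,
possibly repeated. -/
theorem iInf_le_relax_add [NeZero M] (hH : H.Nonempty) {d : ℕ} (hd : 1 ≤ d)
    (hvc : VCLe (supClass H) d) (w : Fin M → X) {g : (X → Bool) → ℝ} (hg : FiniteOn H g) :
    ⨅ h : H, g h.1 ≤ relax H w M g + 37 * √(d * M) := by
  have h1 : ∀ r : Fin M → Bool × Fin M, ∃ h ∈ H, ⨅ h : H, score w r h.1 = score w r h := by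
    intro r
    exact exists_eq_iInf_comp (fun b : Fin M → Bool => ∑ j, sgn (r j).1 * val (b (r j).2)) w hH
  choose f hf hfe using h1
  have h2 : -(37 * √(d * M)) ≤ 𝔼 r : Fin M → Bool × Fin M, ⨅ h : H, score w r h.1 := by
    simp_rw [hfe]
    rw [Fintype.expect_equiv (Equiv.arrowProdEquivProdArrow (Fin M) (fun _ => Bool)
      fun _ => Fin M) (fun r => score w r (f r)) (fun q => score w (fun j => (q.1 j, q.2 j))
        (f fun j => (q.1 j, q.2 j))) fun r => rfl,
      ← Finset.univ_product_univ, Finset.expect_product, Finset.expect_comm]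
    rw [← Fintype.expect_const (ι := Fin M → Fin M) (-(37 * √(d * M)))]
    refine Finset.expect_le_expect fun s _ => ?_
    have h3 := expect_sign_traces_le hd hvc (fun j => w (s j))
      (fun ε j => f (fun j => (!(ε j), s j)) (w (s j)))
      (fun ε => ⟨_, subset_supClass H (hf _), fun j => rfl⟩)
    have h4 : 𝔼 ε : Fin M → Bool, score w (fun j => (ε j, s j)) (f fun j => (ε j, s j))
        = 𝔼 ε : Fin M → Bool, -∑ j, sgn (ε j) * val (f (fun j => (!(ε j), s j)) (w (s j))) := by
      refine Fintype.expect_equiv (Equiv.arrowCongr (Equiv.refl _) Equiv.boolNot) _ _ fun ε => ?_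
      simp [score, Equiv.arrowCongr, Function.comp_def, sgn_not]
    rw [Finset.expect_neg_distrib] at h4
    rw [h4]
    linarith
  have h5 : (⨅ h : H, g h.1) + 𝔼 r : Fin M → Bool × Fin M, ⨅ h : H, score w r h.1
      ≤ relax H w M g := by
    rw [← Fintype.expect_const (ι := Fin M → Bool × Fin M) (⨅ h : H, g h.1),
      ← Finset.expect_add_distrib]
    exact Finset.expect_le_expect fun r _ => hg.iInf_add_le hH (finiteOn_score w r)
  linarith

/-- The prediction that balances the two extreme labels. -/
def balance (H : Set (X → Bool)) (g : (X → Bool) → ℝ) (x : X) : ℝ :=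
  (1 + (⨅ h : H, (g h.1 + |val (h.1 x) - 0|)) - ⨅ h : H, (g h.1 + |val (h.1 x) - 1|)) / 2

variable {g : (X → Bool) → ℝ} (hH : H.Nonempty) (hg : FiniteOn H g) (x : X)
include hH hg

/-- Switching the current label between 0 and 1 changes each loss, hence its infimum, by at most 1.
-/
theorem balance_mem : balance H g x ∈ Set.Icc (0 : ℝ) 1 := by
  have h0 : ∀ c : ℝ, FiniteOn H fun h => g h + |val (h x) - c| := fun c =>
    hg.add (finiteOn_apply (fun b => |val b - c|) x)
  have h1 := (h0 0).iInf_mono (g := fun h => (g h + |val (h x) - 1|) + 1) hH fun h => by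
    cases h x <;> (simp [val]; try linarith)
  have h2 := (h0 1).iInf_mono (g := fun h => (g h + |val (h x) - 0|) + 1) hH fun h => by
    cases h x <;> (simp [val]; try linarith)
  rw [(h0 _).iInf_add_const hH] at h1 h2
  constructor <;> unfold balance <;> linarith

theorem abs_balance_sub_le {v : ℝ} (hv : v ∈ Set.Icc (0 : ℝ) 1) :
    |balance H g x - v| - ⨅ h : H, (g h.1 + |val (h.1 x) - v|)
      ≤ -((⨅ h : H, (g h.1 + val (h.1 x))) + ⨅ h : H, (g h.1 - val (h.1 x))) / 2 := by
  have h0 : ∀ c : ℝ, FiniteOn H fun h => g h + |val (h x) - c| := fun c =>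
    hg.add (finiteOn_apply (fun b => |val b - c|) x)
  have h0' : ∀ c k : ℝ, FiniteOn H fun h => k * (g h + |val (h x) - c|) := fun c k =>
    (h0 c).map₂ (h0 c) fun a _ => k * a
  set Q0 := ⨅ h : H, (g h.1 + |val (h.1 x) - 0|) with hQ0
  set Q1 := ⨅ h : H, (g h.1 + |val (h.1 x) - 1|) with hQ1
  have e0 : ⨅ h : H, (g h.1 + val (h.1 x)) = Q0 := by
    simp [hQ0, abs_of_nonneg (val_nonneg _)]
  have e1 : (⨅ h : H, (g h.1 - val (h.1 x))) + 1 = Q1 := by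
    rw [← FiniteOn.iInf_add_const (f := fun h => g h - val (h x)) hH
      (hg.map₂ (finiteOn_apply val x) (· - ·)) 1]
    refine congrArg iInf (funext fun h => ?_)
    cases h.1 x <;> simp [val]
  -- For binary values, |h - v| is the mean of |h - 0| and |h - 1| with weights 1 - v and v.
  have hmix : (1 - v) * Q0 + v * Q1 ≤ ⨅ h : H, (g h.1 + |val (h.1 x) - v|) := by
    have h1 := (h0' 0 (1 - v)).iInf_add_le hH (h0' 1 v)
    rw [FiniteOn.iInf_const_mul (f := fun h => g h + |val (h x) - 0|) (by linarith [hv.2]),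
      FiniteOn.iInf_const_mul (f := fun h => g h + |val (h x) - 1|) hv.1] at h1
    refine h1.trans (le_of_eq (congrArg iInf (funext fun h => ?_)))
    cases h.1 x
    · simp [val, abs_of_nonneg hv.1]; ring
    · simp [val, abs_of_nonneg (sub_nonneg.2 hv.2)]; ring
  have hb := balance_mem hH hg x
  have hbe : balance H g x = (1 + Q0 - Q1) / 2 := rfl
  set b := balance H g x
  -- Jensen's inequality: the right-hand side is the mean distance from `b` to a Bernoulli label
  -- with mean `v`. With `hmix`, this reduces the bound to the labels 0 and 1, for which `b` gives
  -- the same value.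
  have habs : |b - v| ≤ (1 - v) * b + v * (1 - b) := by
    rw [abs_le]
    constructor <;> nlinarith [hb.1, hb.2, hv.1, hv.2, mul_nonneg hb.1 (sub_nonneg.2 hv.2),
      mul_nonneg hv.1 (sub_nonneg.2 hb.2)]
  have e1' : ⨅ h : H, (g h.1 - val (h.1 x)) = Q1 - 1 := by linarith
  have : (1 - v) * (b - Q0) + v * (1 - b - Q1) = (1 - Q0 - Q1) / 2 := by rw [hbe]; ring
  rw [e0, e1']
  linarith

end

/-! ### The cost of replacing a fresh feature by a draw from an earlier sample -/

section

variable {X : Type u} [MeasurableSpace X] {H : Set (X → Bool)} {M : ℕ}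

theorem measurableTraces_iInf_section (hT : MeasurableTraces H) {ι : Type} [Finite ι]
    (φ : (ι → Bool) → ℝ) (z : ι → X) (ψ : Bool → ℝ) :
    Measurable fun x => ⨅ h : H, (φ (fun i => h.1 (z i)) + ψ (h.1 x)) := by
  have h1 := hT.iInf (ι := Option ι) fun b => φ (fun i => b (some i)) + ψ (b none)
  have h2 : Measurable fun x : X => (fun o : Option ι => o.elim x z) := by
    refine measurable_pi_iff.2 fun o => ?_
    cases o
    · exact measurable_id
    · exact measurable_const
  simpa only [Function.comp_def, Option.elim_none, Option.elim_some] using h1.comp h2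

/-- `g` is a function of the traces on finitely many points. -/
def TraceFunction (g : (X → Bool) → ℝ) : Prop :=
  ∃ (ι : Type) (_ : Finite ι) (φ : (ι → Bool) → ℝ) (z : ι → X), g = fun h => φ fun i => h (z i)

omit [MeasurableSpace X] in
theorem TraceFunction.finiteOn {g : (X → Bool) → ℝ} (hg : TraceFunction g) : FiniteOn H g := by
  obtain ⟨ι, _, φ, z, rfl⟩ := hg
  exact finiteOn_comp φ z

theorem TraceFunction.measurable {g : (X → Bool) → ℝ} (hg : TraceFunction g)
    (hT : MeasurableTraces H) (ψ : Bool → ℝ) :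
    Measurable fun x => ⨅ h : H, (g h.1 + ψ (h.1 x)) := by
  obtain ⟨ι, _, φ, z, rfl⟩ := hg
  exact measurableTraces_iInf_section hT φ z ψ

omit [MeasurableSpace X] in
theorem FiniteOn.exists_bound (hH : H.Nonempty) {g : (X → Bool) → ℝ} (hg : FiniteOn H g)
    (ψ : Bool → ℝ) : ∃ C, ∀ x, |⨅ h : H, (g h.1 + ψ (h.1 x))| ≤ C := by
  have hfin : (Set.image2 (· + ·) (Set.range fun h : H => g h.1) (Set.range ψ)).Finite :=
    Set.Finite.image2 _ hg (Set.finite_range ψ)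
  obtain ⟨C, hC⟩ := (hfin.image fun r => |r|).bddAbove
  refine ⟨C, fun x => hC ?_⟩
  refine ⟨_, ?_, rfl⟩
  have := hH.to_subtype
  obtain ⟨h, hh⟩ := (Set.range_nonempty fun h : H => g h.1 + ψ (h.1 x)).csInf_mem
    (hg.add (finiteOn_apply ψ x))
  exact ⟨g h.1, ⟨h, rfl⟩, ψ (h.1 x), ⟨_, rfl⟩, hh⟩

variable {μ : Measure X} [IsProbabilityMeasure μ] (hH : H.Nonempty)
  (hT : MeasurableTraces H) {g : (X → Bool) → ℝ} (hg : TraceFunction g) (w : Fin M → X)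
include hH hT hg

/-- Up to sign the infimum is sup_h (h(x) - g(h)), so this is `integral_iSup_le` for the function
-g. -/
theorem sum_iInf_sub_le : ∑ i, (⨅ h : H, (g h.1 - val (h.1 (w i))))
      ≤ M * ∫ x, (⨅ h : H, (g h.1 - val (h.1 x))) ∂μ + meanGap μ H w := by
  have hneg : ∀ x, ⨆ h : H, (val (h.1 x) + -g h.1) = -⨅ h : H, (g h.1 - val (h.1 x)) := by
    intro x
    rw [iInf_eq_neg_iSup_neg, neg_neg]
    exact congrArg iSup (funext fun h => by ring)
  have hm : Measurable fun x => ⨅ h : H, (g h.1 - val (h.1 x)) := by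
    simpa only [sub_eq_add_neg] using hg.measurable hT fun b => -val b
  obtain ⟨C, hC⟩ := (hg.finiteOn (H := H)).exists_bound hH fun b => -val b
  simp only [← sub_eq_add_neg] at hC
  have h1 := integral_iSup_le (μ := μ) hH hT (fun h => -g h.1)
    (by
      have h2 : FiniteOn H g := hg.finiteOn
      exact h2.map₂ h2 fun a _ => -a)
    (by simp_rw [hneg]; exact hm.neg) (C := C) (fun x => by rw [hneg, abs_neg]; exact hC x) w
  simp_rw [hneg] at h1
  rw [integral_neg, Finset.sum_neg_distrib] at h1
  linarith

theorem sum_iInf_add_le : ∑ i, (⨅ h : H, (g h.1 + val (h.1 (w i))))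
      ≤ M * ∫ x, (⨅ h : H, (g h.1 + val (h.1 x))) ∂μ + meanGap μ (complClass H) w := by
  have hHc : (complClass H).Nonempty := hH.image _
  -- Replacing h by 1 - h turns g + h into g' - h' + 1, so the previous bound applies to the
  -- complementary class.
  have hcompl : ∀ x, (⨅ h : H, (g h.1 + val (h.1 x)))
      = (⨅ h : complClass H, (g (fun x => !(h.1 x)) - val (h.1 x))) + 1 := by
    intro x
    rw [← FiniteOn.iInf_add_const (f := fun h => g (fun x => !(h x)) - val (h x))
      hHc ?_ 1]
    · refine le_antisymm ?_ ?_
      · have := hHc.to_subtype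
        refine le_ciInf ?_
        rintro ⟨_, ⟨h, hh, rfl⟩⟩
        refine ((hg.finiteOn.add (finiteOn_apply val x)).iInf_le hh).trans (le_of_eq ?_)
        simp [val_not]
        ring
      · have := hH.to_subtype
        refine le_ciInf fun h => ?_
        refine (FiniteOn.iInf_le (H := complClass H)
          (g := fun h => g (fun x => !(h x)) - val (h x) + 1) ?_
          (h := fun x => !(h.1 x)) ⟨h.1, h.2, rfl⟩).trans (le_of_eq ?_)
        · obtain ⟨ι, _, φ, z, rfl⟩ := hg
          have h2 : FiniteOn (complClass H) fun h => φ fun i => !(h (z i)) :=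
            finiteOn_comp (fun b => φ fun i => !(b i)) z
          exact h2.map₂ (finiteOn_apply val x) fun a b => a - b + 1
        · simp [val_not]
          ring
    · obtain ⟨ι, _, φ, z, rfl⟩ := hg
      have h2 : FiniteOn (complClass H) fun h => φ fun i => !(h (z i)) :=
        finiteOn_comp (fun b => φ fun i => !(b i)) z
      exact h2.map₂ (finiteOn_apply val x) fun a b => a - b
  have hg' : TraceFunction fun h : X → Bool => g fun x => !(h x) := by
    obtain ⟨ι, _, φ, z, rfl⟩ := hg
    exact ⟨ι, ‹_›, fun b => φ fun i => !(b i), z, rfl⟩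
  have h1 := sum_iInf_sub_le (μ := μ) hHc hT.complClass hg' w
  simp_rw [hcompl]
  rw [Finset.sum_add_distrib, integral_add, integral_const]
  · simp only [Finset.sum_const, Finset.card_univ, Fintype.card_fin, probReal_univ]
    simp only [nsmul_eq_mul, smul_eq_mul]
    linarith
  · obtain ⟨C, hC⟩ := (hg'.finiteOn (H := complClass H)).exists_bound hHc fun b => -val b
    refine integrable_of_bdd (C := C) ?_ fun x => by simpa only [sub_eq_add_neg] using hC x
    simpa only [sub_eq_add_neg] using hg'.measurable hT.complClass fun b => -val b
  · exact integrable_const _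

end

end

end HybridLearning

namespace HybridLearning

noncomputable section

/-! ### Upper expectations -/

section

variable {α : Type*} [MeasurableSpace α] {μ : Measure α} [IsProbabilityMeasure μ]

/-- The bound `B` keeps the integrals of the majorants bounded below; otherwise their real infimum
would default to 0. -/
theorem upperExp_le {f g : α → ℝ} (hg : Integrable g μ) (hfg : ∀ a, f a ≤ g a) {B : ℝ}
    (hB : ∀ a, B ≤ f a) : upperExp μ f ≤ ∫ a, g a ∂μ := by
  refine ciInf_le ⟨B, ?_⟩ (⟨g, hg, hfg⟩ : {g : α → ℝ // Integrable g μ ∧ ∀ a, f a ≤ g a})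
  rintro _ ⟨g', rfl⟩
  calc B = ∫ _a, B ∂μ := by simp
    _ ≤ ∫ a, g'.1 a ∂μ := integral_mono (integrable_const _) g'.2.1 fun a => (hB a).trans (g'.2.2 a)

/-- The sign of `B` matters when there is no integrable majorant, for then the upper expectation is
the infimum over an empty family, that is 0. -/
theorem le_upperExp {f : α → ℝ} {B : ℝ} (hB0 : B ≤ 0) (hB : ∀ a, B ≤ f a) : B ≤ upperExp μ f := by
  refine Real.le_iInf (fun g => ?_) hB0
  calc B = ∫ _a, B ∂μ := by simp
    _ ≤ ∫ a, g.1 a ∂μ := integral_mono (integrable_const _) g.2.1 fun a => (hB a).trans (g.2.2 a)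

end

/-! ### The prediction rule -/

/-- The largest power of two that is at most `t` (and `1` for `t = 0`). -/
def scale (t : ℕ) : ℕ := 2 ^ Nat.log 2 t

instance (t : ℕ) : NeZero (scale t) := inferInstanceAs (NeZero (2 ^ Nat.log 2 t))

theorem scale_pos (t : ℕ) : 0 < scale t := by unfold scale; positivity

theorem scale_le {t : ℕ} (ht : t ≠ 0) : scale t ≤ t := Nat.pow_log_le_self 2 ht

theorem lt_two_mul_scale (t : ℕ) : t < 2 * scale t := by
  have := Nat.lt_pow_succ_log_self (b := 2) (by norm_num) t
  rw [pow_succ] at this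
  unfold scale
  omega

theorem scale_succ {t : ℕ} (ht : t ≠ 0) :
    (scale (t + 1) = scale t ∧ t + 1 < 2 * scale t) ∨
      (scale (t + 1) = t + 1 ∧ t + 1 = 2 * scale t) := by
  have h1 := scale_le ht
  have h2 := lt_two_mul_scale t
  rcases (Nat.succ_le_of_lt h2).lt_or_eq with h3 | h3
  · left
    refine ⟨?_, h3⟩
    unfold scale at *
    rw [Nat.log_eq_of_pow_le_of_lt_pow (b := 2) (m := Nat.log 2 t) (n := t + 1)]
    · omega
    · rw [pow_succ]; omega
  · right
    refine ⟨?_, h3⟩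
    have h4 : t + 1 = 2 ^ (Nat.log 2 t + 1) := by rw [pow_succ]; unfold scale at h3; omega
    unfold scale
    conv_lhs => rw [h4, Nat.log_pow (by norm_num)]
    exact h4.symm

section

variable {X : Type u}

/-- The first `M` features of `x`. -/
def pool {t : ℕ} (x : Fin (t + 1) → X) (M : ℕ) : Fin M → X := fun i => x (clampIdx t i)

/-- The cumulative absolute loss of `h`. -/
def loss {n : ℕ} (x : Fin n → X) (y : Fin n → I) (h : X → Bool) : ℝ :=
  ∑ i, |val (h (x i)) - (y i : ℝ)|

/-- The loss of the past and the score of the draws `r` from the current pool. -/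
def perturbedLoss {t m : ℕ} (x : Fin (t + 1) → X) (y : Fin t → I)
    (r : Fin m → Bool × Fin (scale t)) (h : X → Bool) : ℝ :=
  loss (fun i => x i.castSucc) y h + score (pool x (scale t)) r h

/-- The prediction when the draws are `r`. -/
def prediction (H : Set (X → Bool)) {t m : ℕ} (x : Fin (t + 1) → X) (y : Fin t → I)
    (r : Fin m → Bool × Fin (scale t)) : I :=
  Set.projIcc 0 1 zero_le_one (balance H (perturbedLoss x y r) (x (Fin.last t)))

/-- The law of the prediction. -/
def predictionPMF (H : Set (X → Bool)) {t : ℕ} (x : Fin (t + 1) → X) (y : Fin t → I) : PMF I :=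
  (PMF.uniformOfFintype (Fin (2 * scale t - (t + 1)) → Bool × Fin (scale t))).map (prediction H x y)

/-- The prediction rule: balance the extreme labels for the randomly perturbed past loss. -/
def rule (H : Set (X → Bool)) : PredictionRule X := fun _ x y =>
  ⟨(predictionPMF H x y).toMeasure, inferInstance⟩

theorem integral_map_uniform {α β : Type*} [Fintype α] [Nonempty α] [MeasurableSpace β]
    (F : α → β) (f : β → ℝ) (hf : Measurable f) :
    ∫ b, f b ∂((PMF.uniformOfFintype α).map F).toMeasure = 𝔼 a, f (F a) := by
  let _ : MeasurableSpace α := ⊤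
  rw [← PMF.toMeasure_map F (PMF.uniformOfFintype α) measurable_from_top,
    integral_map measurable_from_top.aemeasurable hf.aestronglyMeasurable, PMF.integral_eq_sum,
    Fintype.expect_eq_sum_div_card, Finset.sum_div]
  refine Finset.sum_congr rfl fun a _ => ?_
  simp [PMF.uniformOfFintype_apply, div_eq_inv_mul]

theorem bestLoss_eq (H : Set (X → Bool)) {n : ℕ} (x : Fin n → X) (y : Fin n → I) :
    bestLoss H x y = ⨅ h : H, loss x y h.1 := rfl

theorem traceFunction_loss {n : ℕ} (x : Fin n → X) (y : Fin n → I) : TraceFunction (loss x y) :=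
  ⟨Fin n, inferInstance, fun b => ∑ i, |val (b i) - (y i : ℝ)|, x, rfl⟩

theorem traceFunction_perturbedLoss {t m : ℕ} (x : Fin (t + 1) → X) (y : Fin t → I)
    (r : Fin m → Bool × Fin (scale t)) : TraceFunction (perturbedLoss x y r) :=
  ⟨Fin (t + 1), inferInstance, fun b => ∑ i, |val (b (Fin.castSucc i)) - (y i : ℝ)|
    + ∑ j, sgn (r j).1 * val (b (clampIdx t (r j).2)), x, rfl⟩

/-- The potential of the game. -/
def potential (H : Set (X → Bool)) : (t : ℕ) → (Fin t → X) → (Fin t → I) → ℝ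
  | 0, _, _ => 0
  | t + 1, x, y =>
      -relax H (pool x (scale (t + 1))) (2 * scale (t + 1) - (t + 1)) (loss x y)

/-- The cost of enlarging the pool after `t` rounds. -/
def switchCost (d t : ℕ) : ℝ := if scale t = t then 37 * √(d * t) else 0

/-- The expected loss of potential in round `t`. -/
def roundCost [MeasurableSpace X] (μ : Measure X) (H : Set (X → Bool)) (d : ℕ) :
    (t : ℕ) → (Fin t → X) → ℝ
  | 0, _ => 1 + switchCost d 1
  | t + 1, x => (meanGap μ H (pool x (scale (t + 1)))
      + meanGap μ (complClass H) (pool x (scale (t + 1)))) / (2 * scale (t + 1))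
      + switchCost d (t + 2)

theorem neg_bestLoss_le_potential {H : Set (X → Bool)} (hH : H.Nonempty) {t : ℕ} (x : Fin t → X)
    (y : Fin t → I) : -bestLoss H x y ≤ potential H t x y := by
  rw [bestLoss_eq]
  cases t with
  | zero => simp [potential, loss]
  | succ t => exact neg_le_neg (relax_le_iInf hH _ (traceFunction_loss x y).finiteOn)

theorem loss_snoc {t : ℕ} (x : Fin t → X) (y : Fin t → I) (x' : X) (y' : I) (h : X → Bool) :
    loss (Fin.snoc x x' : Fin (t + 1) → X) (Fin.snoc y y' : Fin (t + 1) → I) h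
      = loss x y h + |val (h x') - (y' : ℝ)| := by
  simp [loss, Fin.sum_univ_castSucc]

theorem pool_snoc {t : ℕ} (x : Fin (t + 1) → X) (x' : X) {M : ℕ} (hM : M ≤ t + 1) :
    pool (Fin.snoc x x' : Fin (t + 2) → X) M = pool x M := by
  funext i
  have h1 : clampIdx (t + 1) i = (clampIdx t i).castSucc := by
    ext
    simp only [clampIdx, Fin.val_castSucc]
    omega
  simp only [pool, h1]
  exact Fin.snoc_castSucc (α := fun _ => X) x' x _

variable {H : Set (X → Bool)} (hH : H.Nonempty) {d : ℕ} (hd : 1 ≤ d) (hvc : VCLe (supClass H) d)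
include hH hd hvc

theorem potential_one_le (x : Fin 1 → X) (y : Fin 1 → I) :
    potential H 1 x y ≤ switchCost d 1 := by
  have h1 := iInf_le_relax_add hH hd hvc (pool x (scale 1)) (g := loss x y)
    (traceFunction_loss x y).finiteOn
  have h2 : 0 ≤ ⨅ h : H, loss x y h.1 :=
    Real.iInf_nonneg fun h => Finset.sum_nonneg fun i _ => abs_nonneg _
  have h3 : scale 1 = 1 := by simp [scale]
  simp only [potential, switchCost, zero_add]
  rw [if_pos h3]
  rw [show 2 * scale 1 - 1 = scale 1 by rw [h3]]
  rw [h3] at h1 ⊢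
  linarith

/-- Within an epoch the pool stays and only the new loss is added. At a power of two the old playout
has just run out of draws, and a new one over the enlarged pool is opened at the price `switchCost`.
-/
theorem potential_succ_le {t : ℕ} (x : Fin (t + 1) → X) (y : Fin (t + 1) → I) (x' : X) (y' : I) :
    potential H (t + 2) (Fin.snoc x x') (Fin.snoc y y')
      ≤ -relax H (pool x (scale (t + 1))) (2 * scale (t + 1) - (t + 2))
          (fun h => loss x y h + |val (h x') - (y' : ℝ)|) + switchCost d (t + 2) := by
  have hl : loss (Fin.snoc x x' : Fin (t + 2) → X) (Fin.snoc y y' : Fin (t + 2) → I)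
      = fun h => loss x y h + |val (h x') - (y' : ℝ)| := funext fun h => loss_snoc x y x' y' h
  have hle := scale_le (t := t + 1) (by omega)
  rcases scale_succ (t := t + 1) (by omega) with ⟨h1, h2⟩ | ⟨h1, h2⟩
  · have h3 : scale (t + 2) ≠ t + 2 := by
      intro h4
      have : scale (t + 2) = scale (t + 1) := h1
      omega
    simp only [potential, switchCost]
    rw [if_neg h3, add_zero, hl, show scale (t + 1 + 1) = scale (t + 1) from h1, pool_snoc x x' hle]
  · have h3 := iInf_le_relax_add hH hd hvc (pool (Fin.snoc x x' : Fin (t + 2) → X) (scale (t + 2)))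
      (g := fun h => loss x y h + |val (h x') - (y' : ℝ)|)
      (by rw [← hl]; exact (traceFunction_loss _ _).finiteOn)
    have h4 : scale (t + 2) = t + 2 := h1
    have h5 : 2 * scale (t + 1) - (t + 2) = 0 := by omega
    have h6 : 2 * scale (t + 2) - (t + 2) = scale (t + 2) := by omega
    simp only [potential, switchCost]
    rw [if_pos h4, h5, relax_zero, hl]
    rw [show 2 * scale (t + 1 + 1) - (t + 1 + 1) = scale (t + 2) from h6]
    have h7 : ((scale (t + 2) : ℕ) : ℝ) = ((t + 2 : ℕ) : ℝ) := by rw [h4]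
    rw [h7] at h3
    linarith

omit hd hvc in
/-- One round of the game, for a fixed feature and label. -/
theorem expect_abs_sub_relax_le {t : ℕ} (x : Fin (t + 1) → X) (y : Fin t → I) (m : ℕ) (y' : I) :
    𝔼 r : Fin m → Bool × Fin (scale t), |(prediction H x y r : ℝ) - (y' : ℝ)|
      + -relax H (pool x (scale t)) m (fun h => loss (fun i => x i.castSucc) y h
          + |val (h (x (Fin.last t))) - (y' : ℝ)|)
      ≤ 𝔼 r : Fin m → Bool × Fin (scale t),
        -((⨅ h : H, (perturbedLoss x y r h.1 + val (h.1 (x (Fin.last t)))))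
          + ⨅ h : H, (perturbedLoss x y r h.1 - val (h.1 (x (Fin.last t))))) / 2 := by
  rw [relax, ← Finset.expect_neg_distrib, ← Finset.expect_add_distrib]
  refine Finset.expect_le_expect fun r _ => ?_
  have hg : FiniteOn H (perturbedLoss x y r) := (traceFunction_perturbedLoss x y r).finiteOn
  have h1 := abs_balance_sub_le hH hg (x (Fin.last t)) y'.2
  have h2 : (prediction H x y r : ℝ) = balance H (perturbedLoss x y r) (x (Fin.last t)) := by
    rw [prediction, Set.projIcc_of_mem zero_le_one (balance_mem hH hg _)]
  have h3 : ∀ h : H, loss (fun i => x i.castSucc) y h.1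
      + |val (h.1 (x (Fin.last t))) - (y' : ℝ)| + score (pool x (scale t)) r h.1
      = perturbedLoss x y r h.1 + |val (h.1 (x (Fin.last t))) - (y' : ℝ)| := fun h => by
    rw [perturbedLoss]; ring
  simp_rw [h3, h2]
  linarith

end

theorem traceFunction_add_score {X : Type u} {t m M : ℕ} (x : Fin (t + 1) → X) (y : Fin (t + 1) → I)
    (r : Fin m → Bool × Fin M) :
    TraceFunction fun h => loss x y h + score (pool x M) r h :=
  ⟨Fin (t + 1), inferInstance, fun b => ∑ i, |val (b i) - (y i : ℝ)|
    + ∑ j, sgn (r j).1 * val (b (clampIdx t (r j).2)), x, rfl⟩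

/-! ### One round, averaged over the new feature. -/

section

variable {X : Type u} [MeasurableSpace X] {μ : Measure X} [IsProbabilityMeasure μ]
  {H : Set (X → Bool)}

/-- The value of a round as a function of the new feature. -/
def roundValue (H : Set (X → Bool)) {t : ℕ} (x : Fin (t + 1) → X) (y : Fin (t + 1) → I)
    (x' : X) : ℝ :=
  𝔼 r : Fin (2 * scale (t + 1) - (t + 2)) → Bool × Fin (scale (t + 1)),
    -((⨅ h : H, (loss x y h.1 + score (pool x (scale (t + 1))) r h.1 + val (h.1 x')))
      + ⨅ h : H, (loss x y h.1 + score (pool x (scale (t + 1))) r h.1 - val (h.1 x'))) / 2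

variable (hH : H.Nonempty) (hT : MeasurableTraces H)

include hH hT

theorem integrable_iInf_add {g : (X → Bool) → ℝ} (hg : TraceFunction g) :
    Integrable (fun x => ⨅ h : H, (g h.1 + val (h.1 x))) μ := by
  obtain ⟨C, hC⟩ := (hg.finiteOn (H := H)).exists_bound hH val
  exact integrable_of_bdd (hg.measurable hT val) hC

theorem integrable_iInf_sub {g : (X → Bool) → ℝ} (hg : TraceFunction g) :
    Integrable (fun x => ⨅ h : H, (g h.1 - val (h.1 x))) μ := by
  obtain ⟨C, hC⟩ := (hg.finiteOn (H := H)).exists_bound hH fun b => -val b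
  exact integrable_of_bdd (hg.measurable hT fun b => -val b) hC

theorem integrable_roundValue {t : ℕ} (x : Fin (t + 1) → X) (y : Fin (t + 1) → I) :
    Integrable (roundValue H x y) μ := by
  unfold roundValue
  simp_rw [Fintype.expect_eq_sum_div_card]
  refine Integrable.div_const (integrable_finsetSum _ fun r _ => ?_) _
  exact ((integrable_iInf_add hH hT (traceFunction_add_score x y r)).add
    (integrable_iInf_sub hH hT (traceFunction_add_score x y r))).neg.div_const 2

/-- A round leaves a fair sign attached to the new feature. Both signs are moved from the feature to
the pool at the cost of the two gaps, and `relax_succ` recognises the result as the relaxation with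
one more draw. -/
theorem integral_roundValue_le {t : ℕ} (x : Fin (t + 1) → X) (y : Fin (t + 1) → I) :
    ∫ x', roundValue H x y x' ∂μ ≤ potential H (t + 1) x y
      + (meanGap μ H (pool x (scale (t + 1)))
        + meanGap μ (complClass H) (pool x (scale (t + 1)))) / (2 * scale (t + 1)) := by
  set M := scale (t + 1) with hM
  set m := 2 * M - (t + 2) with hm
  set w := pool x M with hw
  have hM0 : (0 : ℝ) < M := by exact_mod_cast scale_pos _
  have hi1 := fun r : Fin m → Bool × Fin M =>
    integrable_iInf_add (μ := μ) hH hT (traceFunction_add_score x y r)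
  have hi2 := fun r : Fin m → Bool × Fin M =>
    integrable_iInf_sub (μ := μ) hH hT (traceFunction_add_score x y r)
  set c := (meanGap μ H w + meanGap μ (complClass H) w) / (2 * M) with hc
  have hr : ∀ r : Fin m → Bool × Fin M,
      ∫ x', -((⨅ h : H, (loss x y h.1 + score w r h.1 + val (h.1 x')))
      + ⨅ h : H, (loss x y h.1 + score w r h.1 - val (h.1 x'))) / 2 ∂μ
      ≤ -(𝔼 p : Bool × Fin M, ⨅ h : H, (loss x y h.1 + score w r h.1
          + sgn p.1 * val (h.1 (w p.2)))) + c := by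
    intro r
    have h1 := sum_iInf_add_le (μ := μ) hH hT (traceFunction_add_score x y r) w
    have h2 := sum_iInf_sub_le (μ := μ) hH hT (traceFunction_add_score x y r) w
    rw [integral_div, integral_neg, integral_add (hi1 r) (hi2 r), ← Finset.univ_product_univ,
      Finset.expect_product, Fintype.expect_eq_sum_div_card, Fintype.sum_bool,
      Fintype.expect_eq_sum_div_card, Fintype.expect_eq_sum_div_card]
    simp only [sgn, if_true, Bool.false_eq_true, if_false, one_mul, neg_mul, ← sub_eq_add_neg,
      Fintype.card_bool, Fintype.card_fin, Nat.cast_ofNat]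
    set A := ∫ x', ⨅ h : H, (loss x y h.1 + score w r h.1 + val (h.1 x')) ∂μ
    set B := ∫ x', ⨅ h : H, (loss x y h.1 + score w r h.1 - val (h.1 x')) ∂μ
    set A' := ∑ i, ⨅ h : H, (loss x y h.1 + score w r h.1 + val (h.1 (w i)))
    set B' := ∑ i, ⨅ h : H, (loss x y h.1 + score w r h.1 - val (h.1 (w i)))
    have h3 : (A' + B') / (2 * M) ≤ (A + B) / 2 + c := by
      rw [hc, div_le_iff₀ (by positivity), add_mul, div_mul_cancel₀ _ (by positivity)]
      linarith
    have h4 : (A' / M + B' / M) / 2 = (A' + B') / (2 * M) := by field_simp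
    linarith
  have hm1 : 2 * M - (t + 1) = m + 1 := by
    have := lt_two_mul_scale (t + 1)
    omega
  have hpot : potential H (t + 1) x y = 𝔼 r : Fin m → Bool × Fin M,
      -(𝔼 p : Bool × Fin M, ⨅ h : H, (loss x y h.1 + score w r h.1
          + sgn p.1 * val (h.1 (w p.2)))) := by
    rw [Finset.expect_neg_distrib, ← relax_succ]
    simp only [potential]
    rw [← hM, hm1]
  have hexp : ∫ x', roundValue H x y x' ∂μ = 𝔼 r : Fin m → Bool × Fin M,
      ∫ x', -((⨅ h : H, (loss x y h.1 + score w r h.1 + val (h.1 x')))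
      + ⨅ h : H, (loss x y h.1 + score w r h.1 - val (h.1 x'))) / 2 ∂μ := by
    have hi3 : ∀ r : Fin m → Bool × Fin M, Integrable (fun x' =>
        -((⨅ h : H, (loss x y h.1 + score w r h.1 + val (h.1 x')))
          + ⨅ h : H, (loss x y h.1 + score w r h.1 - val (h.1 x'))) / 2) μ :=
      fun r => ((hi1 r).add (hi2 r)).neg.div_const 2
    unfold roundValue
    simp_rw [Fintype.expect_eq_sum_div_card]
    rw [integral_div, integral_finsetSum _ fun r _ => hi3 r]
  rw [hexp, hpot, ← Fintype.expect_const (ι := Fin m → Bool × Fin M) c,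
    ← Finset.expect_add_distrib]
  exact Finset.expect_le_expect fun r _ => hr r

end

end

end HybridLearning

namespace HybridLearning

noncomputable section

/-! ### Analysis of the game -/

theorem abs_coe_sub_coe_le_one (a b : I) : |(a : ℝ) - (b : ℝ)| ≤ 1 :=
  abs_le.2 ⟨by linarith [a.2.1, b.2.2], by linarith [a.2.2, b.2.1]⟩

section

variable {X : Type u} [MeasurableSpace X] {H : Set (X → Bool)}

omit [MeasurableSpace X] in
theorem bestLoss_le (hH : H.Nonempty) {t : ℕ} (x : Fin t → X) (y : Fin t → I) :
    bestLoss H x y ≤ t := by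
  obtain ⟨h, hh⟩ := hH
  refine ((traceFunction_loss x y).finiteOn.iInf_le hh).trans ?_
  calc loss x y h ≤ ∑ _i : Fin t, (1 : ℝ) := by
        refine Finset.sum_le_sum fun i _ => abs_le.2 ⟨?_, ?_⟩
        · linarith [val_nonneg (h (x i)), (y i).2.2]
        · linarith [val_le_one (h (x i)), (y i).2.1]
    _ = t := by simp

/-- Supplies the lower bound required by `upperExp_le`, using that the best loss never exceeds the
number of rounds. -/
theorem neg_le_gameValue (hH : H.Nonempty) (Φ : PredictionRule X) (μ : Measure X)
    [IsProbabilityMeasure μ] : ∀ (k t : ℕ) (x : Fin t → X) (y p : Fin t → I),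
      -((t + k : ℕ) : ℝ) ≤ gameValue H Φ μ k t x y p
  | 0, t, x, y, p => by
    have h1 := bestLoss_le hH x y
    have h2 : 0 ≤ ∑ i, |(p i : ℝ) - (y i : ℝ)| := Finset.sum_nonneg fun i _ => abs_nonneg _
    simp only [gameValue, add_zero]
    linarith
  | k + 1, t, x, y, p => by
    have h0 : -((t + (k + 1) : ℕ) : ℝ) ≤ 0 := neg_nonpos.2 (Nat.cast_nonneg _)
    have ih := fun x' y' p' => neg_le_gameValue hH Φ μ k (t + 1) (Fin.snoc x x') (Fin.snoc y y')
      (Fin.snoc p p')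
    have he : t + 1 + k = t + (k + 1) := by ring
    rw [he] at ih
    refine le_upperExp h0 fun x' => ?_
    -- An unbounded family of labels has real supremum 0, which is still above the nonpositive
    -- bound.
    by_cases hb : BddAbove (Set.range fun y' : I =>
        upperExp (Φ t (Fin.snoc x x') y : Measure I) fun p' =>
          gameValue H Φ μ k (t + 1) (Fin.snoc x x') (Fin.snoc y y') (Fin.snoc p p'))
    · exact (le_upperExp h0 fun p' => ih x' 0 p').trans (le_ciSup hb 0)
    · exact h0.trans (Real.sSup_of_not_bddAbove hb).ge

/-- The expected sum of the costs of the next `k` rounds. -/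
def futureCost (μ : Measure X) (H : Set (X → Bool)) (d : ℕ) : (k t : ℕ) → (Fin t → X) → ℝ
  | 0, _, _ => 0
  | k + 1, t, x =>
      roundCost μ H d t x + ∫ x', futureCost μ H d k (t + 1) (Fin.snoc x x') ∂μ

theorem measurable_snoc (t : ℕ) :
    Measurable fun q : (Fin t → X) × X => (Fin.snoc q.1 q.2 : Fin (t + 1) → X) := by
  refine measurable_pi_iff.2 fun i => ?_
  refine Fin.lastCases ?_ (fun i => ?_) i
  · simpa using measurable_snd
  · simp only [Fin.snoc_castSucc]
    exact (measurable_pi_apply i).comp measurable_fst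

variable {μ : Measure X} [IsProbabilityMeasure μ]

theorem measurable_pool {t : ℕ} (M : ℕ) : Measurable fun x : Fin (t + 1) → X => pool x M :=
  measurable_pi_iff.2 fun _ => measurable_pi_apply _

theorem measurable_roundCost (hT : MeasurableTraces H) (d t : ℕ) :
    Measurable (roundCost μ H d t) := by
  cases t with
  | zero => exact measurable_const
  | succ t =>
    have h1 := (hT.measurable_meanGap (μ := μ) (M := scale (t + 1))).comp (measurable_pool (t := t) _)
    have h2 := (hT.complClass.measurable_meanGap (μ := μ) (M := scale (t + 1))).comp
      (measurable_pool (t := t) _)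
    exact ((h1.add h2).div_const _).add_const _

theorem exists_bound_roundCost (H : Set (X → Bool)) (d t : ℕ) :
    ∃ C, ∀ x, |roundCost μ H d t x| ≤ C := by
  cases t with
  | zero => exact ⟨|1 + switchCost d 1|, fun x => le_rfl⟩
  | succ t =>
    have hM : (0 : ℝ) < scale (t + 1) := by exact_mod_cast scale_pos _
    refine ⟨1 + |switchCost d (t + 2)|, fun x => (abs_add_le _ _).trans (add_le_add_left ?_ _)⟩
    rw [abs_div, abs_of_pos (by positivity : (0 : ℝ) < 2 * scale (t + 1)),
      div_le_one (by positivity)]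
    have h1 := abs_meanGap_le (μ := μ) (F := H) (pool x (scale (t + 1)))
    have h2 := abs_meanGap_le (μ := μ) (F := complClass H) (pool x (scale (t + 1)))
    refine (abs_add_le _ _).trans ?_
    linarith

theorem futureCost_regular (hT : MeasurableTraces H) (d : ℕ) : ∀ k t : ℕ,
    Measurable (futureCost μ H d k t) ∧ ∃ C, ∀ x, |futureCost μ H d k t x| ≤ C
  | 0, t => ⟨measurable_const, 0, fun x => by simp [futureCost]⟩
  | k + 1, t => by
    obtain ⟨h1, C, hC⟩ := futureCost_regular hT d k (t + 1)
    obtain ⟨C', hC'⟩ := exists_bound_roundCost (μ := μ) H d t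
    constructor
    · refine (measurable_roundCost hT d t).add ?_
      have h2 := h1.comp (measurable_snoc (X := X) t)
      exact (h2.stronglyMeasurable.integral_prod_right' (ν := μ)).measurable
    · refine ⟨C' + C, fun x => (abs_add_le _ _).trans (add_le_add (hC' x) ?_)⟩
      have h3 := norm_integral_le_of_norm_le_const (μ := μ)
        (f := fun x' => futureCost μ H d k (t + 1) (Fin.snoc x x')) (C := C)
        (Filter.Eventually.of_forall fun x' => hC _)
      simpa using h3

theorem integrable_futureCost_snoc (hT : MeasurableTraces H) (d k t : ℕ) (x : Fin t → X) :
    Integrable (fun x' => futureCost μ H d k (t + 1) (Fin.snoc x x')) μ := by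
  obtain ⟨h1, C, hC⟩ := futureCost_regular (μ := μ) hT d k (t + 1)
  have h2 := h1.comp ((measurable_snoc (X := X) t).comp (measurable_const (a := x).prodMk
    measurable_id))
  exact integrable_of_bdd (C := C) h2 fun x' => hC _

omit [MeasurableSpace X] in
theorem integral_rule {t : ℕ} (x : Fin (t + 1) → X) (y : Fin t → I) (c : ℝ) (y' : I) :
    ∫ p : I, (c + |(p : ℝ) - (y' : ℝ)|) ∂(rule H t x y : Measure I)
      = c + 𝔼 r : Fin (2 * scale t - (t + 1)) → Bool × Fin (scale t),
          |(prediction H x y r : ℝ) - (y' : ℝ)| := by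
  have h1 := integral_map_uniform (prediction H (m := 2 * scale t - (t + 1)) x y)
    (fun p : I => c + |(p : ℝ) - (y' : ℝ)|)
    (by fun_prop)
  have h2 : (rule H t x y : Measure I) = (predictionPMF H x y).toMeasure := rfl
  rw [h2, predictionPMF, h1, Finset.expect_add_distrib, Fintype.expect_const]

omit [MeasurableSpace X] in
theorem integrable_rule {t : ℕ} (x : Fin (t + 1) → X) (y : Fin t → I) (c : ℝ) (y' : I) :
    Integrable (fun p : I => c + |(p : ℝ) - (y' : ℝ)|) (rule H t x y : Measure I) := by
  refine integrable_of_bdd (C := |c| + 1) (by fun_prop) fun p => (abs_add_le _ _).trans ?_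
  rw [abs_abs]
  exact add_le_add_right (abs_coe_sub_coe_le_one p y') _

/-- The value of the game is at most the current loss, the potential and the future costs. -/
theorem gameValue_le (hH : H.Nonempty) (hT : MeasurableTraces H) {d : ℕ} (hd : 1 ≤ d)
    (hvc : VCLe (supClass H) d) : ∀ (k t : ℕ) (x : Fin t → X) (y p : Fin t → I),
      gameValue H (rule H) μ k t x y p
        ≤ ∑ i, |(p i : ℝ) - (y i : ℝ)| + potential H t x y + futureCost μ H d k t x
  | 0, t, x, y, p => by
    have := neg_bestLoss_le_potential hH x y
    simp only [gameValue, futureCost]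
    linarith
  | k + 1, t, x, y, p => by
    have ih := fun x' y' p' => gameValue_le hH hT hd hvc k (t + 1) (Fin.snoc x x') (Fin.snoc y y')
      (Fin.snoc p p')
    have hlow := fun x' y' p' => neg_le_gameValue hH (rule H) μ k (t + 1) (Fin.snoc x x')
      (Fin.snoc y y') (Fin.snoc p p')
    have hlow0 : -((t + 1 + k : ℕ) : ℝ) ≤ 0 := neg_nonpos.2 (Nat.cast_nonneg _)
    set L := ∑ i, |(p i : ℝ) - (y i : ℝ)| with hL
    have hint := integrable_futureCost_snoc (μ := μ) hT d k t x
    -- the value of the round, after the feature and the label have been revealed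
    have hinner : ∀ x' y',
        (upperExp (rule H t (Fin.snoc x x') y : Measure I) fun p' =>
          gameValue H (rule H) μ k (t + 1) (Fin.snoc x x') (Fin.snoc y y') (Fin.snoc p p'))
        ≤ L + potential H (t + 1) (Fin.snoc x x') (Fin.snoc y y')
          + futureCost μ H d k (t + 1) (Fin.snoc x x')
          + 𝔼 r : Fin (2 * scale t - (t + 1)) → Bool × Fin (scale t),
              |(prediction H (Fin.snoc x x') y r : ℝ) - (y' : ℝ)| := by
      intro x' y'
      rw [← integral_rule]
      refine upperExp_le (integrable_rule _ _ _ _) (fun p' => (ih x' y' p').trans (le_of_eq ?_))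
        (hlow x' y')
      simp only [Fin.sum_univ_castSucc, Fin.snoc_castSucc, Fin.snoc_last]
      ring
    have hlow1 : ∀ x', -((t + 1 + k : ℕ) : ℝ) ≤ ⨆ y' : I,
        upperExp (rule H t (Fin.snoc x x') y : Measure I) fun p' =>
          gameValue H (rule H) μ k (t + 1) (Fin.snoc x x') (Fin.snoc y y') (Fin.snoc p p') := by
      intro x'
      by_cases hb : BddAbove (Set.range fun y' : I =>
          upperExp (rule H t (Fin.snoc x x') y : Measure I) fun p' =>
            gameValue H (rule H) μ k (t + 1) (Fin.snoc x x') (Fin.snoc y y') (Fin.snoc p p'))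
      · exact (le_upperExp hlow0 fun p' => hlow x' 0 p').trans (le_ciSup hb 0)
      · exact hlow0.trans (Real.sSup_of_not_bddAbove hb).ge
    simp only [gameValue, futureCost]
    cases t with
    -- In the first round there is no earlier feature to draw from, so its loss is simply bounded by
    -- 1.
    | zero =>
      have hround : ∀ x', (⨆ y' : I,
          upperExp (rule H 0 (Fin.snoc x x') y : Measure I) fun p' =>
            gameValue H (rule H) μ k 1 (Fin.snoc x x') (Fin.snoc y y') (Fin.snoc p p'))
          ≤ L + (1 + switchCost d 1) + futureCost μ H d k 1 (Fin.snoc x x') := by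
        intro x'
        refine ciSup_le fun y' => (hinner x' y').trans ?_
        have h1 := potential_one_le hH hd hvc (Fin.snoc x x') (Fin.snoc y y')
        have h2 : 𝔼 r : Fin (2 * scale 0 - (0 + 1)) → Bool × Fin (scale 0),
            |(prediction H (Fin.snoc x x') y r : ℝ) - (y' : ℝ)| ≤ 1 := by
          rw [← Fintype.expect_const (ι := Fin (2 * scale 0 - (0 + 1)) → Bool × Fin (scale 0))
            (1 : ℝ)]
          exact Finset.expect_le_expect fun r _ => abs_coe_sub_coe_le_one _ _
        linarith
      refine (upperExp_le ((integrable_const _).add hint) hround hlow1).trans ?_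
      have h6 : ∫ x', (L + (1 + switchCost d 1) + futureCost μ H d k 1 (Fin.snoc x x')) ∂μ
          = L + (1 + switchCost d 1) + ∫ x', futureCost μ H d k 1 (Fin.snoc x x') ∂μ := by
        rw [integral_add (integrable_const _) hint]
        simp
      refine h6.le.trans (le_of_eq ?_)
      simp only [potential, roundCost]
      ring
    | succ t =>
      have hround : ∀ x', (⨆ y' : I,
          upperExp (rule H (t + 1) (Fin.snoc x x') y : Measure I) fun p' =>
            gameValue H (rule H) μ k (t + 2) (Fin.snoc x x') (Fin.snoc y y') (Fin.snoc p p'))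
          ≤ L + switchCost d (t + 2) + roundValue H x y x'
            + futureCost μ H d k (t + 2) (Fin.snoc x x') := by
        intro x'
        refine ciSup_le fun y' => (hinner x' y').trans ?_
        have h1 := potential_succ_le hH hd hvc x y x' y'
        have h2 := expect_abs_sub_relax_le hH (Fin.snoc x x' : Fin (t + 2) → X) y
          (2 * scale (t + 1) - (t + 2)) y'
        have h3 : ∀ r : Fin (2 * scale (t + 1) - (t + 2)) → Bool × Fin (scale (t + 1)),
            ∀ h : X → Bool, perturbedLoss (Fin.snoc x x' : Fin (t + 2) → X) y r h
              = loss x y h + score (pool x (scale (t + 1))) r h := by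
          intro r h
          rw [perturbedLoss, pool_snoc x x' (scale_le (by omega))]
          simp only [Fin.snoc_castSucc]
        simp only [h3, Fin.snoc_castSucc, Fin.snoc_last,
          pool_snoc x x' (scale_le (t := t + 1) (by omega))] at h2
        have h4 : roundValue H x y x' = 𝔼 r : Fin (2 * scale (t + 1) - (t + 2)) →
            Bool × Fin (scale (t + 1)),
          -((⨅ h : H, (loss x y h.1 + score (pool x (scale (t + 1))) r h.1 + val (h.1 x')))
          + ⨅ h : H, (loss x y h.1 + score (pool x (scale (t + 1))) r h.1 - val (h.1 x'))) / 2 := rfl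
        rw [← h4] at h2
        have h5 : 2 * scale (t + 1) - (t + 1 + 1) = 2 * scale (t + 1) - (t + 2) := rfl
        rw [h5]
        linarith
      have hrv := integrable_roundValue (μ := μ) hH hT x y
      refine (upperExp_le (((integrable_const _).add hrv).add hint) hround hlow1).trans ?_
      have h6 : ∫ x', (L + switchCost d (t + 2) + roundValue H x y x'
            + futureCost μ H d k (t + 2) (Fin.snoc x x')) ∂μ
          = L + switchCost d (t + 2) + ∫ x', roundValue H x y x' ∂μ
            + ∫ x', futureCost μ H d k (t + 2) (Fin.snoc x x') ∂μ := by
        have h7 : Integrable (fun x' => L + switchCost d (t + 2) + roundValue H x y x') μ :=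
          (integrable_const _).add hrv
        rw [integral_add h7 hint, integral_add (integrable_const _) hrv]
        simp
      refine h6.le.trans ?_
      have h8 := integral_roundValue_le (μ := μ) hH hT x y
      simp only [roundCost]
      linarith

/-! ### The expected costs -/

/-- Distinct coordinates of an i.i.d. sample are again i.i.d.; it is applied to the pool. -/
theorem measurePreserving_comp_injective {m n : ℕ} (e : Fin m → Fin n)
    (he : Function.Injective e) :
    MeasurePreserving (fun x : Fin n → X => x ∘ e) (Measure.pi fun _ => μ)
      (Measure.pi fun _ => μ) := by
  classical
  have hm : Measurable fun x : Fin n → X => x ∘ e :=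
    measurable_pi_iff.2 fun i => measurable_pi_apply _
  refine ⟨hm, (Measure.pi_eq fun s hs => ?_).symm⟩
  rw [Measure.map_apply hm (MeasurableSet.univ_pi hs)]
  have h1 : (fun x : Fin n → X => x ∘ e) ⁻¹' Set.univ.pi s
      = Set.univ.pi fun j => ⋂ i, ⋂ (_ : e i = j), s i := by
    ext x
    simp only [Set.mem_preimage, Set.mem_univ_pi, Set.mem_iInter, Function.comp]
    exact ⟨fun h j i hij => hij ▸ h i, fun h i => h (e i) i rfl⟩
  rw [h1, Measure.pi_pi]
  refine (Fintype.prod_of_injective e he _ _ (fun j hj => ?_) fun i => ?_).symm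
  · have : (⋂ i, ⋂ (_ : e i = j), s i) = Set.univ := by
      refine Set.eq_univ_of_forall fun x => ?_
      simp only [Set.mem_iInter]
      exact fun i hi => absurd ⟨i, hi⟩ hj
    rw [this, measure_univ]
  · congr 1
    ext x
    simp only [Set.mem_iInter]
    exact ⟨fun h j hj => he hj ▸ h, fun h => h i rfl⟩

theorem integral_snoc {t : ℕ} {f : (Fin (t + 1) → X) → ℝ} (hf : Measurable f) {C : ℝ}
    (hC : ∀ x, |f x| ≤ C) :
    ∫ x, ∫ x', f (Fin.snoc x x') ∂μ ∂(Measure.pi fun _ : Fin t => μ)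
      = ∫ x, f x ∂(Measure.pi fun _ : Fin (t + 1) => μ) := by
  have h1 := ((measurePreserving_piFinSuccAbove (fun _ : Fin (t + 1) => μ)
    (Fin.last t)).symm).integral_comp' f
  rw [← h1]
  have h2 : ∀ q : X × (Fin t → X),
      (MeasurableEquiv.piFinSuccAbove (fun _ : Fin (t + 1) => X) (Fin.last t)).symm q
        = Fin.snoc q.2 q.1 := by
    intro q
    simp [MeasurableEquiv.piFinSuccAbove, Fin.insertNthEquiv, Fin.insertNth_last']
  simp_rw [h2]
  have h3 : Measurable fun q : X × (Fin t → X) => f (Fin.snoc q.2 q.1) :=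
    hf.comp ((measurable_snoc (X := X) t).comp measurable_swap)
  exact (integral_prod_symm (μ := μ) (ν := Measure.pi fun _ : Fin t => μ)
    (fun q : X × (Fin t → X) => f (Fin.snoc q.2 q.1)) (integrable_of_bdd h3 fun q => hC _)).symm

/-- A bound for the expected cost of round `t`. -/
def meanCost (d : ℕ) : ℕ → ℝ
  | 0 => 1 + switchCost d 1
  | t + 1 => 74 * √(d * scale (t + 1)) / scale (t + 1) + switchCost d (t + 2)

theorem integral_roundCost_le (hT : MeasurableTraces H) {d : ℕ} (hd : 1 ≤ d)
    (hvc : VCLe (supClass H) d) (hvc' : VCLe (supClass (complClass H)) d) (t : ℕ) :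
    ∫ x, roundCost μ H d t x ∂(Measure.pi fun _ : Fin t => μ) ≤ meanCost d t := by
  cases t with
  | zero => simp [roundCost, meanCost]
  | succ t =>
    have hM : (0 : ℝ) < scale (t + 1) := by exact_mod_cast scale_pos _
    have hle := scale_le (t := t + 1) (by omega)
    have hmp : MeasurePreserving (fun x : Fin (t + 1) → X => pool x (scale (t + 1)))
        (Measure.pi fun _ => μ) (Measure.pi fun _ => μ) := by
      refine measurePreserving_comp_injective (fun i => clampIdx t i) fun i j hij => ?_
      have := congrArg Fin.val hij
      simp only [clampIdx] at this
      ext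
      omega
    have key : ∀ F : Set (X → Bool), MeasurableTraces F → VCLe (supClass F) d →
        Integrable (fun x : Fin (t + 1) → X => meanGap μ F (pool x (scale (t + 1))))
          (Measure.pi fun _ => μ) ∧
        ∫ x : Fin (t + 1) → X, meanGap μ F (pool x (scale (t + 1))) ∂(Measure.pi fun _ => μ)
          ≤ 74 * √(d * scale (t + 1)) := by
      intro F hF hFvc
      have h1 := hF.measurable_meanGap (μ := μ) (M := scale (t + 1))
      refine ⟨integrable_of_bdd (h1.comp hmp.measurable) fun x => abs_meanGap_le _, ?_⟩
      have h2 := integral_map (μ := Measure.pi fun _ : Fin (t + 1) => μ)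
        hmp.measurable.aemeasurable (f := fun w => meanGap μ F w) h1.aestronglyMeasurable
      rw [hmp.map_eq] at h2
      rw [← h2]
      exact integral_meanGap_le hF hd hFvc
    obtain ⟨i1, h1⟩ := key H hT hvc
    obtain ⟨i2, h2⟩ := key _ hT.complClass hvc'
    simp only [roundCost, meanCost]
    have i3 : Integrable (fun x : Fin (t + 1) → X => (meanGap μ H (pool x (scale (t + 1)))
        + meanGap μ (complClass H) (pool x (scale (t + 1)))) / (2 * scale (t + 1)))
        (Measure.pi fun _ => μ) := (i1.add i2).div_const _
    rw [integral_add i3 (integrable_const _), integral_div,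
      integral_add i1 i2]
    simp only [integral_const, probReal_univ, one_smul]
    gcongr ?_ + _
    rw [div_le_div_iff₀ (by positivity) hM]
    nlinarith

theorem integral_futureCost_le (hT : MeasurableTraces H) {d : ℕ} (hd : 1 ≤ d)
    (hvc : VCLe (supClass H) d) (hvc' : VCLe (supClass (complClass H)) d) : ∀ k t : ℕ,
    ∫ x, futureCost μ H d k t x ∂(Measure.pi fun _ : Fin t => μ)
      ≤ ∑ j ∈ Finset.range k, meanCost d (t + j)
  | 0, t => by simp [futureCost]
  | k + 1, t => by
    have ih := integral_futureCost_le hT hd hvc hvc' k (t + 1)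
    obtain ⟨h1, C, hC⟩ := futureCost_regular (μ := μ) hT d k (t + 1)
    obtain ⟨h2, C2, hC2⟩ := futureCost_regular (μ := μ) hT d (k + 1) t
    obtain ⟨C', hC'⟩ := exists_bound_roundCost (μ := μ) H d t
    have hr : Integrable (roundCost μ H d t) (Measure.pi fun _ : Fin t => μ) :=
      integrable_of_bdd (measurable_roundCost hT d t) hC'
    have hfi : Integrable (fun x => ∫ x', futureCost μ H d k (t + 1) (Fin.snoc x x') ∂μ)
        (Measure.pi fun _ : Fin t => μ) := by
      have h3 := (integrable_of_bdd (μ := Measure.pi fun _ : Fin t => μ) h2 hC2).sub hr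
      refine h3.congr (Filter.Eventually.of_forall fun x => ?_)
      simp [futureCost]
    simp only [futureCost]
    rw [integral_add hr hfi, integral_snoc h1 hC, Finset.sum_range_succ']
    have h4 := integral_roundCost_le (μ := μ) hT hd hvc hvc' t
    have h5 : ∑ j ∈ Finset.range k, meanCost d (t + 1 + j)
        = ∑ j ∈ Finset.range k, meanCost d (t + (j + 1)) :=
      Finset.sum_congr rfl fun j _ => by congr 1; ring
    rw [h5] at ih
    simp only [add_zero]
    linarith

end

/-- The two terms on the right telescope separately: the first absorbs the exchanges of features,
round by round, and the second the switches of pool, since it grows exactly when `scale` doubles. -/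
theorem sum_meanCost_le {d : ℕ} (hd : 1 ≤ d) (t : ℕ) :
    ∑ j ∈ Finset.range (t + 1), meanCost d j
      ≤ 300 * √(d * (t + 1 : ℕ)) + 130 * √(d * scale (t + 1)) := by
  have hd' : (1 : ℝ) ≤ d := by exact_mod_cast hd
  have hsd : 1 ≤ √(d : ℝ) := Real.one_le_sqrt.2 hd'
  induction t with
  | zero =>
    simp [meanCost, switchCost, scale]
    linarith
  | succ t ih =>
    rw [Finset.sum_range_succ]
    set M := scale (t + 1) with hM
    have hM0 : (0 : ℝ) < M := by exact_mod_cast scale_pos _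
    have hlt : ((t + 2 : ℕ) : ℝ) ≤ 2 * M := by
      exact_mod_cast Nat.succ_le_of_lt (lt_two_mul_scale (t + 1))
    have hd0 : (0 : ℝ) ≤ d := by linarith
    simp only [Real.sqrt_mul hd0] at ih ⊢
    -- With a = √(t+2) and b = √(t+1) one has a - b = 1/(a + b) ≥ 1/(4√M), because t + 2 ≤ 2M; and
    -- 74 · 4 ≤ 300.
    have hstep : 74 * (√(d : ℝ) * √M) / M
        ≤ 300 * (√(d : ℝ) * √((t + 1 + 1 : ℕ) : ℝ)) - 300 * (√(d : ℝ) * √((t + 1 : ℕ) : ℝ)) := by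
      set a := √((t + 1 + 1 : ℕ) : ℝ) with ha
      set b := √((t + 1 : ℕ) : ℝ) with hb
      set m := √(M : ℝ) with hm
      have hm0 : 0 < m := Real.sqrt_pos.2 hM0
      have ha2 : a ^ 2 = ((t + 1 + 1 : ℕ) : ℝ) := Real.sq_sqrt (Nat.cast_nonneg _)
      have hb2 : b ^ 2 = ((t + 1 : ℕ) : ℝ) := Real.sq_sqrt (Nat.cast_nonneg _)
      have hm2 : m ^ 2 = M := Real.sq_sqrt hM0.le
      have ha0 : 0 ≤ a := Real.sqrt_nonneg _
      have hb0 : 0 ≤ b := Real.sqrt_nonneg _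
      have hdiff : (a - b) * (a + b) = 1 := by
        have : a ^ 2 - b ^ 2 = 1 := by rw [ha2, hb2]; push_cast; ring
        linarith [this, show (a - b) * (a + b) = a ^ 2 - b ^ 2 by ring]
      have ham : a ≤ 2 * m := by
        refine le_of_sq_le_sq ?_ (by positivity)
        rw [mul_pow, ha2, hm2]
        have : ((t + 1 + 1 : ℕ) : ℝ) ≤ 2 * M := hlt
        linarith
      have hba : b ≤ a := Real.sqrt_le_sqrt (by push_cast; linarith)
      have h1 : 1 ≤ (a - b) * (4 * m) := by
        rw [← hdiff]
        exact mul_le_mul_of_nonneg_left (by linarith) (by linarith)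
      rw [← hm2, div_le_iff₀ (by positivity)]
      have h2 : 0 ≤ √(d : ℝ) * m := by positivity
      nlinarith [mul_le_mul_of_nonneg_left h1 h2]
    have hswitch : switchCost d (t + 2) ≤ 130 * (√(d : ℝ) * √(scale (t + 1 + 1) : ℝ))
        - 130 * (√(d : ℝ) * √M) := by
      rcases scale_succ (t := t + 1) (by omega) with ⟨h1, h2⟩ | ⟨h1, h2⟩
      · have h3 : scale (t + 2) ≠ t + 2 := by
          intro h4
          have h5 : scale (t + 2) = scale (t + 1) := h1
          have h6 := scale_le (t := t + 1) (by omega)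
          omega
        rw [switchCost, if_neg h3, h1]
        linarith
      · have h3 : scale (t + 2) = t + 2 := h1
        have h4 : ((t + 2 : ℕ) : ℝ) = 2 * M := by exact_mod_cast h2
        rw [switchCost, if_pos h3, h1, Real.sqrt_mul hd0]
        have h5 : √((t + 1 + 1 : ℕ) : ℝ) = √2 * √M := by
          rw [← Real.sqrt_mul (by norm_num), ← h4]
        rw [h5]
        -- What is needed is 37√2 ≤ 130(√2 - 1), that is 93√2 ≥ 130.
        have h7 : (1.4 : ℝ) ≤ √2 := Real.le_sqrt_of_sq_le (by norm_num)
        have h8 : 0 ≤ √(d : ℝ) * √(M : ℝ) := by positivity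
        nlinarith [mul_le_mul_of_nonneg_right h7 h8]
    have hmc : meanCost d (t + 1) = 74 * (√(d : ℝ) * √M) / M + switchCost d (t + 2) := by
      simp only [meanCost, Real.sqrt_mul hd0, hM]
    rw [hmc]
    linarith

theorem regret_rule_le {X : Type u} [MeasurableSpace X] {H : Set (X → Bool)} (hH : H.Nonempty)
    (hm : MeasurableClass H) {d : ℕ} (hd : 1 ≤ d) (hvc : VCLe (supClass H) d)
    (hvc' : VCLe (infClass H) d) (T : ℕ) : regret H (rule H) T ≤ 430 * √(d * T) := by
  refine Real.iSup_le (fun μ => ?_) (by positivity)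
  have hT := hm.measurableTraces
  have h1 := gameValue_le (μ := (μ : Measure X)) hH hT hd hvc T 0 ![] ![] ![]
  have h2 := integral_futureCost_le (μ := (μ : Measure X)) hT hd hvc hvc'.supClass_complClass T 0
  have h3 : ∫ x, futureCost (μ : Measure X) H d T 0 x ∂(Measure.pi fun _ : Fin 0 => (μ : Measure X))
      = futureCost (μ : Measure X) H d T 0 ![] := by
    have : ∀ x : Fin 0 → X, x = ![] := fun x => Subsingleton.elim _ _
    simp_rw [this]
    simp
  rw [h3] at h2
  simp only [zero_add] at h2
  have h4 : gameValue H (rule H) (μ : Measure X) T 0 ![] ![] ![]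
      ≤ ∑ j ∈ Finset.range T, meanCost d j := by
    refine h1.trans ?_
    simpa [potential] using h2
  refine h4.trans ?_
  cases T with
  | zero => simp
  | succ t =>
    refine (sum_meanCost_le hd t).trans ?_
    have h5 : √((d : ℝ) * scale (t + 1)) ≤ √((d : ℝ) * (t + 1 : ℕ)) := by
      refine Real.sqrt_le_sqrt (mul_le_mul_of_nonneg_left ?_ (Nat.cast_nonneg _))
      exact_mod_cast scale_le (by omega)
    linarith

end

end HybridLearning

namespace HybridLearning

noncomputable section

/-! ### Reasoning about programs -/

section Semantics

variable {t : ℕ} (oracle : Query t → ℝ≥0 → ℝ)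

/-- Started in `s`, the program `P` stops in a determined state satisfying `R`. -/
def Reaches (P : Program) (s : State t) (R : State t → Prop) : Prop :=
  ∃ s', P.exec oracle s = PMF.pure s' ∧ R s'

variable {oracle} {s : State t} {R : State t → Prop}

theorem Reaches.mono {P : Program} {R' : State t → Prop} (h : Reaches oracle P s R)
    (hR : ∀ s', R s' → R' s') : Reaches oracle P s R' := by
  obtain ⟨s', h1, h2⟩ := h
  exact ⟨s', h1, hR _ h2⟩

theorem reaches_skip (h : R s.tick) : Reaches oracle .skip s R := ⟨_, rfl, h⟩

theorem reaches_setNat {a e : NatExpr}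
    (h : R { s.tick with nat := Function.update s.nat (a.eval s) (e.eval s) }) :
    Reaches oracle (.setNat a e) s R := ⟨_, rfl, h⟩

theorem reaches_setReal {a : NatExpr} {e : RealExpr}
    (h : R { s.tick with real := Function.update s.real (a.eval s) (e.eval s) }) :
    Reaches oracle (.setReal a e) s R := ⟨_, rfl, h⟩

theorem reaches_pushSample {i : NatExpr} {y : RealExpr}
    (h : R { s.tick with
      query := { s.query with
        samples := (clampIdx t (i.eval s), Set.projIcc 0 1 zero_le_one (y.eval s)) ::
          s.query.samples } }) :
    Reaches oracle (.pushSample i y) s R := ⟨_, rfl, h⟩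

theorem reaches_pushSign {ε : ℤˣ} {i : NatExpr}
    (h : R { s.tick with
      query := { s.query with signs := (clampIdx t (i.eval s), ε) :: s.query.signs } }) :
    Reaches oracle (.pushSign ε i) s R := ⟨_, rfl, h⟩

theorem reaches_ask {a : NatExpr} {c : RealExpr}
    (h : R { s.tick with
      real := Function.update s.real (a.eval s) (oracle s.query (c.eval s).toNNReal)
      query := ⟨[], []⟩ }) :
    Reaches oracle (.ask a c) s R := ⟨_, rfl, h⟩

theorem exec_seq_of_pure {P Q : Program} {s' : State t}
    (h : P.exec oracle s = PMF.pure s') :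
    (Program.seq P Q).exec oracle s = Q.exec oracle s' := by
  simp only [Program.exec, h, PMF.pure_bind]

theorem reaches_seq {P Q : Program} (h : Reaches oracle P s fun s' => Reaches oracle Q s' R) :
    Reaches oracle (.seq P Q) s R := by
  obtain ⟨s', h1, s'', h2, h3⟩ := h
  exact ⟨s'', (exec_seq_of_pure h1).trans h2, h3⟩

theorem reaches_iteNat {e f : NatExpr} {P Q : Program}
    (hP : e.eval s ≤ f.eval s → Reaches oracle P s.tick R)
    (hQ : f.eval s < e.eval s → Reaches oracle Q s.tick R) :
    Reaches oracle (.iteNat e f P Q) s R := by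
  unfold Reaches
  simp only [Program.exec]
  split_ifs with h
  · exact hP h
  · exact hQ (not_le.1 h)

theorem reaches_loop {e : NatExpr} {P : Program} {n : ℕ} (hn : e.eval s = n)
    (Inv : ℕ → State t → Prop) (h0 : Inv 0 s.tick)
    (hstep : ∀ k < n, ∀ s', Inv k s' → Reaches oracle P s'.tick (Inv (k + 1)))
    (hR : ∀ s', Inv n s' → R s') :
    Reaches oracle (.loop e P) s R := by
  subst hn
  have key : ∀ k ≤ e.eval s, ∃ s', (Nat.rec (PMF.pure s.tick)
      (fun _ D => D.bind fun s' => P.exec oracle s'.tick) k : PMF (State t)) = PMF.pure s'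
      ∧ Inv k s' := by
    intro k
    induction k with
    | zero => exact fun _ => ⟨_, rfl, h0⟩
    | succ k ih =>
      intro hk
      obtain ⟨s', h1, h2⟩ := ih (by omega)
      obtain ⟨s'', h3, h4⟩ := hstep k (by omega) s' h2
      refine ⟨s'', ?_, h4⟩
      simp only [h1, PMF.pure_bind, h3]
  obtain ⟨s', h1, h2⟩ := key _ le_rfl
  exact ⟨s', h1, hR _ h2⟩

end Semantics

/-! ### Uniform distributions -/

theorem uniform_map_equiv {α β : Type*} [Fintype α] [Fintype β] [Nonempty α] [Nonempty β]
    (e : α ≃ β) : (PMF.uniformOfFintype α).map e = PMF.uniformOfFintype β := by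
  classical
  ext b
  rw [PMF.map_apply, tsum_eq_single (e.symm b)]
  · simp [Fintype.card_congr e]
  · intro a ha
    rw [if_neg]
    rintro rfl
    simp at ha

theorem uniform_snoc {α : Type*} [Fintype α] [Nonempty α] (k : ℕ) :
    PMF.uniformOfFintype (Fin (k + 1) → α) = (PMF.uniformOfFintype (Fin k → α)).bind fun r =>
      (PMF.uniformOfFintype α).map fun a => (Fin.snoc r a : Fin (k + 1) → α) := by
  classical
  ext r
  rw [PMF.bind_apply, tsum_eq_single (Fin.init r), PMF.map_apply, tsum_eq_single (r (Fin.last k))]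
  · rw [if_pos (Fin.snoc_init_self r).symm]
    simp only [PMF.uniformOfFintype_apply, Fintype.card_fun, Fintype.card_fin, pow_succ,
      Nat.cast_mul]
    rw [ENNReal.mul_inv (Or.inr (ENNReal.natCast_ne_top _)) (Or.inl (ENNReal.natCast_ne_top _))]
  · intro a ha
    rw [if_neg]
    intro h
    apply ha
    rw [h]
    simp
  · intro r' hr'
    rw [PMF.map_apply]
    simp only [mul_eq_zero]
    right
    refine ENNReal.tsum_eq_zero.2 fun a => if_neg fun h => hr' ?_
    rw [h]
    simp

/-- A loop whose body makes one uniform random choice. -/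
theorem exec_loop_uniform {t : ℕ} {oracle : Query t → ℝ≥0 → ℝ} {s : State t} {e : NatExpr}
    {P : Program} {α : Type} [Fintype α] [Nonempty α] {n : ℕ} (hn : e.eval s = n)
    (Inv : (k : ℕ) → (Fin k → α) → State t → Prop) (h0 : ∀ r, Inv 0 r s.tick)
    (hstep : ∀ k < n, ∀ (r : Fin k → α) (s' : State t), Inv k r s' →
      ∃ G : α → State t, P.exec oracle s'.tick = (PMF.uniformOfFintype α).map G ∧
        ∀ a, Inv (k + 1) (Fin.snoc r a) (G a)) :
    ∃ F : (Fin n → α) → State t,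
      (Program.loop e P).exec oracle s = (PMF.uniformOfFintype (Fin n → α)).map F ∧
        ∀ r, Inv n r (F r) := by
  subst hn
  have key : ∀ k ≤ e.eval s, ∃ F : (Fin k → α) → State t, (Nat.rec (PMF.pure s.tick)
      (fun _ D => D.bind fun s' => P.exec oracle s'.tick) k : PMF (State t))
        = (PMF.uniformOfFintype (Fin k → α)).map F ∧ ∀ r, Inv k r (F r) := by
    intro k
    induction k with
    | zero =>
      refine fun _ => ⟨fun _ => s.tick, ?_, h0⟩
      exact (PMF.map_const _ _).symm
    | succ k ih =>
      intro hk
      obtain ⟨F, h1, h2⟩ := ih (by omega)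
      choose G hG hGi using fun r => hstep k (by omega) r (F r) (h2 r)
      refine ⟨fun r => G (Fin.init r) (r (Fin.last k)), ?_, fun r => ?_⟩
      · simp only [h1]
        rw [PMF.bind_map, uniform_snoc, PMF.map_bind]
        refine congrArg _ (funext fun r => ?_)
        simp only [Function.comp, hG, PMF.map_comp]
        congr 1
        funext a
        simp
      · simpa using hGi (Fin.init r) (r (Fin.last k))
  exact key _ le_rfl

theorem update_three_ten_add (f : ℕ → ℕ) (v j : ℕ) :
    Function.update f 3 v (10 + j) = f (10 + j) := Function.update_of_ne (by omega) _ _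

theorem update_ten_add_of_lt (f : ℕ → ℕ) (v k : ℕ) {j : ℕ} (hj : j < 10) :
    Function.update f (10 + k) v j = f j := Function.update_of_ne (by omega) _ _

/-! ### The program -/

/-- Cell `0` holds `t`, cell `1` the size of the pool, cell `2` the number of draws, cell `3` a
counter; the draws are stored from cell `10` on. -/
def cell (a : ℕ) : NatExpr := .read (.const a)

/-- Increase the counter. -/
def incr : Program := .setNat (.const 3) (.add (cell 3) (.const 1))

/-- The draw with the index in the counter. -/
def currentDraw : NatExpr := .read (.add (.const 10) (cell 3))

/-- Compute the size of the pool and the number of draws. -/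
def prepareProgram : Program :=
  .seq (.setNat (.const 1) (.const 1)) <|
  .seq (.loop (cell 0) (.iteNat (.add (cell 1) (cell 1)) (cell 0)
    (.setNat (.const 1) (.add (cell 1) (cell 1))) .skip)) <|
  .seq (.setNat (.const 2) (.sub (.add (cell 1) (cell 1)) (.add (cell 0) (.const 1)))) <|
  .setNat (.const 3) (.const 0)

/-- Make the draw with the index in the counter. -/
def drawStep : Program :=
  .seq (.rand (.add (.const 10) (cell 3)) (.sub (.add (cell 1) (cell 1)) (.const 1))) incr

/-- Make the draws. A draw below the size of the pool stands for a positive sign. -/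
def drawProgram : Program := .loop (cell 2) drawStep

/-- Query the oracle with the label `b` for the current feature. -/
def queryProgram (b : ℕ) : Program :=
  .seq (.setNat (.const 3) (.const 0)) <|
  .seq (.loop (cell 0) (.seq (.pushSample (cell 3) (.read (cell 3))) incr)) <|
  .seq (.pushSample (cell 0) (.const b)) <|
  .seq (.setNat (.const 3) (.const 0)) <|
  .seq (.loop (cell 2) (.seq
    (.iteNat (.add currentDraw (.const 1)) (cell 1) (.pushSign 1 currentDraw)
      (.pushSign (-1) (.sub currentDraw (cell 1)))) incr)) <|
  .ask (.add (cell 0) (.const b)) (.const 1)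

/-- Query both extreme labels and balance them. -/
def balanceProgram : Program :=
  .seq (queryProgram 0) <|
  .seq (queryProgram 1) <|
  .setReal (.const 0) (.scale (1 / 2) (.sub (.add (.const 1) (.read (cell 0)))
    (.read (.add (cell 0) (.const 1)))))

/-- The program that implements `rule`. -/
def ruleProgram : Program := .seq prepareProgram (.seq drawProgram balanceProgram)

/-! ### Correctness and running time of the program. -/

section Correctness

variable {X : Type u} {H : Set (X → Bool)} {t : ℕ} {x : Fin (t + 1) → X} {y : Fin t → I}

/-- The number of draws in round `t`. -/
def numDraws (t : ℕ) : ℕ := 2 * scale t - (t + 1)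

theorem reaches_prepare (oracle : Query t → ℝ≥0 → ℝ) (y : Fin t → I) :
    Reaches oracle prepareProgram (initState y) fun s =>
      s.nat 0 = t ∧ s.nat 1 = scale t ∧ s.nat 2 = numDraws t ∧ s.nat 3 = 0 ∧
        s.real = (initState y).real ∧ s.query = ⟨[], []⟩ ∧ s.time ≤ 4 + 3 * t := by
  -- The guarded doubling stops growing at `scale t`, and `t` passes are enough since log₂ t ≤ t.
  -- For t = 0 there is no pass and cell 1 keeps the value 1 = `scale 0`.
  refine reaches_seq (reaches_setNat (reaches_seq (reaches_loop (n := t)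
    (by simp [NatExpr.eval, cell, State.tick, initState])
    (fun k s => s.nat 0 = t ∧ s.nat 1 = 2 ^ min k (Nat.log 2 t) ∧ s.real = (initState y).real ∧
      s.query = ⟨[], []⟩ ∧ s.time ≤ 2 + 3 * k) ?_ ?_ ?_)))
  · simp [NatExpr.eval, State.tick, initState]
  · rintro k hk s ⟨h0, h1, hr, hq, ht⟩
    have hpow : 2 ^ min k (Nat.log 2 t) + 2 ^ min k (Nat.log 2 t) ≤ t ↔ k < Nat.log 2 t := by
      rw [← two_mul, ← pow_succ', ← Nat.le_log_iff_pow_le (by norm_num) (by omega)]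
      omega
    refine reaches_iteNat (fun hc => reaches_setNat ?_) fun hc => reaches_skip ?_
    · simp only [NatExpr.eval, cell, State.tick, h0, h1] at hc
      have hlt := hpow.1 hc
      simp [NatExpr.eval, cell, State.tick, h0, h1, hr, hq]
      refine ⟨?_, by omega⟩
      rw [min_eq_left (by omega), min_eq_left (by omega), pow_succ]
      omega
    · simp only [NatExpr.eval, cell, State.tick, h0, h1] at hc
      have hlt : ¬ k < Nat.log 2 t := fun h => absurd (hpow.2 h) (by omega)
      simp [State.tick, h0, h1, hr, hq]
      refine ⟨?_, by omega⟩
      rw [min_eq_right (by omega), min_eq_right (by omega)]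
  · rintro s ⟨h0, h1, hr, hq, ht⟩
    have he' : (min t (Nat.log 2 t)) = Nat.log 2 t := min_eq_right (Nat.log_le_self 2 t)
    rw [he'] at h1
    refine reaches_seq (reaches_setNat (reaches_setNat ?_))
    simp [NatExpr.eval, cell, State.tick, h0, h1, hr, hq, numDraws, scale, two_mul]
    omega

/-- The machine is ready to query the oracle with the draws `v`. -/
structure Ready (y : Fin t → I) (v : Fin (numDraws t) → ℕ) (s : State t) : Prop where
  nat_zero : s.nat 0 = t
  nat_one : s.nat 1 = scale t
  nat_two : s.nat 2 = numDraws t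
  draws : ∀ j : Fin (numDraws t), s.nat (10 + (j : ℕ)) = v j
  labels : ∀ i : Fin t, s.real (i : ℕ) = y i
  query : s.query = ⟨[], []⟩

/-- The contribution of the draw `v` to the signed sum. -/
def drawTerm (x : Fin (t + 1) → X) (h : X → Bool) (v : ℕ) : ℝ :=
  if v + 1 ≤ scale t then val (h (x (clampIdx t v))) else -val (h (x (clampIdx t (v - scale t))))

/-- The answer of the oracle for the label `c`. -/
def answer (H : Set (X → Bool)) (x : Fin (t + 1) → X) (y : Fin t → I)
    (v : Fin (numDraws t) → ℕ) (c : ℝ) : ℝ :=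
  ⨅ h : H, (loss (fun i => x i.castSucc) y h.1 + ∑ j, drawTerm x h.1 (v j)
    + |val (h.1 (x (Fin.last t))) - c|)

/-- The sum over the samples on the tape. -/
def sampleSum (x : Fin (t + 1) → X) (h : X → Bool) (q : Query t) : ℝ :=
  (q.samples.map fun s => |val (h (x s.1)) - (s.2 : ℝ)|).sum

/-- The sum over the signs on the tape. -/
def signSum (x : Fin (t + 1) → X) (h : X → Bool) (q : Query t) : ℝ :=
  (q.signs.map fun s => ((s.2 : ℤ) : ℝ) * val (h (x s.1))).sum

theorem reaches_query {v : Fin (numDraws t) → ℕ} {s : State t} (hs : Ready y v s) {b : ℕ}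
    (hb : b ≤ 1) :
    Reaches (mixedERM H x) (queryProgram b) s fun s' =>
      Ready y v s' ∧ s'.real = Function.update s.real (t + b) (answer H x y v b) ∧
        s'.time ≤ s.time + 6 + 3 * t + 4 * numDraws t := by
  obtain ⟨n0, n1, n2, hd, hl, hq⟩ := hs
  set T := s.time with hT
  set ρ := s.real with hρ
  have hb01 : ((b : ℚ) : ℝ) ∈ Set.Icc (0 : ℝ) 1 := by
    constructor
    · push_cast; positivity
    · push_cast; exact_mod_cast hb
  refine reaches_seq (reaches_setNat (reaches_seq (reaches_loop (n := t)
    (by simp [NatExpr.eval, cell, State.tick, n0])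
    (fun k s' => s'.nat 0 = t ∧ s'.nat 1 = scale t ∧ s'.nat 2 = numDraws t ∧ s'.nat 3 = k ∧
      (∀ j, s'.nat (10 + j) = s.nat (10 + j)) ∧ s'.real = ρ ∧
      (∀ h : X → Bool, sampleSum x h s'.query
        = ∑ i ∈ Finset.range k, |val (h (x (clampIdx t i))) - ρ i|) ∧
      s'.query.signs = [] ∧ s'.time ≤ T + 2 + 3 * k) ?_ ?_ ?_)))
  · simp [NatExpr.eval, State.tick, n0, n1, n2, hq, sampleSum, hρ, hT, update_three_ten_add]
  · rintro k hk s' ⟨h0, h1, h2, h3, hdr, hr, hsum, hsig, ht⟩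
    have hlab : ρ k ∈ Set.Icc (0 : ℝ) 1 := by
      rw [show ρ k = y ⟨k, hk⟩ from hl ⟨k, hk⟩]
      exact (y _).2
    refine reaches_seq (reaches_pushSample (reaches_setNat ?_))
    simp [NatExpr.eval, RealExpr.eval, cell, State.tick, h0, h1, h2, h3, hr, hsig, hdr, update_three_ten_add]
    refine ⟨fun h => ?_, by omega⟩
    have := hsum h
    simp only [sampleSum] at this ⊢
    simp only [List.map_cons, List.sum_cons, this, Finset.sum_range_succ,
      Set.projIcc_of_mem zero_le_one hlab]
    ring
  · rintro s' ⟨h0, h1, h2, h3, hdr, hr, hsum, hsig, ht⟩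
    refine reaches_seq (reaches_pushSample (reaches_seq (reaches_setNat
      (reaches_seq (reaches_loop (n := numDraws t)
        (by simp [NatExpr.eval, cell, State.tick, h2]) (fun k s'' => s''.nat 0 = t ∧ s''.nat 1 = scale t ∧
        s''.nat 2 = numDraws t ∧ s''.nat 3 = k ∧ (∀ j, s''.nat (10 + j) = s.nat (10 + j)) ∧
        s''.real = ρ ∧
        (∀ h : X → Bool, sampleSum x h s''.query
          = ∑ i ∈ Finset.range t, |val (h (x (clampIdx t i))) - ρ i|
            + |val (h (x (Fin.last t))) - b|) ∧
        (∀ h : X → Bool, signSum x h s''.query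
          = ∑ j ∈ Finset.range k, drawTerm x h (s.nat (10 + j))) ∧
        s''.time ≤ T + 5 + 3 * t + 4 * k) ?_ ?_ ?_)))))
    · have hlast : clampIdx t t = Fin.last t := by
        ext
        simp [clampIdx]
      simp [NatExpr.eval, RealExpr.eval, cell, State.tick, h0, h1, h2, hr, hsig, hdr, signSum,
        update_three_ten_add]
      refine ⟨fun h => ?_, by omega⟩
      have := hsum h
      have hbb : ((b : ℕ) : ℝ) ∈ Set.Icc (0 : ℝ) 1 := by simpa using hb01
      simp only [sampleSum] at this ⊢
      simp only [List.map_cons, List.sum_cons, this, hlast, Set.projIcc_of_mem zero_le_one hbb]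
      ring
    · rintro k hk s'' ⟨h0, h1, h2, h3, hdr, hr, hsum, hsgn, ht⟩
      refine reaches_seq (reaches_iteNat (fun hc => reaches_pushSign (reaches_setNat ?_))
        fun hc => reaches_pushSign (reaches_setNat ?_))
      · simp only [NatExpr.eval, cell, currentDraw, State.tick, h1, h3, hdr] at hc
        simp [NatExpr.eval, cell, currentDraw, State.tick, h0, h1, h2, h3, hr, hdr,
          update_three_ten_add]
        refine ⟨fun h => ?_, fun h => ?_, by omega⟩
        · exact hsum h
        · have := hsgn h
          simp only [signSum] at this ⊢
          simp only [List.map_cons, List.sum_cons, this, Finset.sum_range_succ, drawTerm, if_pos hc]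
          simp
          ring
      · simp only [NatExpr.eval, cell, currentDraw, State.tick, h1, h3, hdr] at hc
        simp [NatExpr.eval, cell, currentDraw, State.tick, h0, h1, h2, h3, hr, hdr,
          update_three_ten_add]
        refine ⟨fun h => ?_, fun h => ?_, by omega⟩
        · exact hsum h
        · have := hsgn h
          simp only [signSum] at this ⊢
          simp only [List.map_cons, List.sum_cons, this, Finset.sum_range_succ, drawTerm,
            if_neg (not_le.2 hc)]
          simp
          ring
    · rintro s'' ⟨g0, g1, g2, g3, gdr, gr, gsum, gsgn, gt⟩
      refine reaches_ask ⟨⟨?_, ?_, ?_, fun j => ?_, fun i => ?_, ?_⟩, ?_, ?_⟩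
      · exact g0
      · exact g1
      · exact g2
      · exact (gdr j).trans (hd j)
      -- The answers go to the real cells t and t + 1, beyond the labels, so the second query still
      -- finds the labels intact.
      · have : (i : ℕ) ≠ t + b := by have := i.2; omega
        simp [NatExpr.eval, cell, g0, Function.update_of_ne this, gr, hl]
      · rfl
      · have hans : mixedERM H x s''.query 1 = answer H x y v b := by
          unfold mixedERM answer
          refine congrArg iInf (funext fun h => ?_)
          have e1 := gsum h.1
          have e2 := gsgn h.1
          simp only [sampleSum] at e1
          simp only [signSum] at e2
          rw [e1, e2, Finset.sum_range, Finset.sum_range]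
          simp only [hd, NNReal.coe_one, one_mul, loss]
          have e3 : ∀ i : Fin t, clampIdx t i = i.castSucc := fun i => by
            ext
            simp only [clampIdx, Fin.val_castSucc]
            omega
          simp only [e3, hl]
          ring
        simp [NatExpr.eval, RealExpr.eval, cell, g0, gr, hans]
      · simp [State.tick]
        omega

theorem reaches_balance {v : Fin (numDraws t) → ℕ} {s : State t} (hs : Ready y v s) :
    Reaches (mixedERM H x) balanceProgram s fun s' =>
      s'.real 0 = (1 + answer H x y v 0 - answer H x y v 1) / 2 ∧
        s'.time ≤ s.time + 13 + 6 * t + 8 * numDraws t := by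
  refine reaches_seq ((reaches_query hs zero_le_one).mono ?_)
  rintro s1 ⟨hs1, hr1, ht1⟩
  refine reaches_seq ((reaches_query hs1 le_rfl).mono ?_)
  rintro s2 ⟨hs2, hr2, ht2⟩
  refine reaches_setReal ?_
  simp [NatExpr.eval, RealExpr.eval, cell, State.tick, hs2.nat_zero, hr2, hr1]
  constructor
  · ring
  · omega

theorem exec_draw {s : State t} (h0 : s.nat 0 = t) (h1 : s.nat 1 = scale t)
    (h2 : s.nat 2 = numDraws t) (h3 : s.nat 3 = 0) (hr : s.real = (initState y).real)
    (hq : s.query = ⟨[], []⟩) :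
    ∃ F : (Fin (numDraws t) → Fin (scale t + scale t - 1 + 1)) → State t,
      drawProgram.exec (mixedERM H x) s = (PMF.uniformOfFintype _).map F ∧
        ∀ r, Ready y (fun j => r j) (F r) ∧ (F r).time ≤ s.time + 1 + 3 * numDraws t := by
  have he : (cell 2).eval s = numDraws t := by simp [NatExpr.eval, cell, h2]
  obtain ⟨F, hF, hFi⟩ := exec_loop_uniform (s := s) (e := cell 2) (n := numDraws t) he
    (P := drawStep)
    (α := Fin (scale t + scale t - 1 + 1))
    (fun k r s' => s'.nat 0 = t ∧ s'.nat 1 = scale t ∧ s'.nat 2 = numDraws t ∧ s'.nat 3 = k ∧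
      (∀ j : Fin k, s'.nat (10 + (j : ℕ)) = r j) ∧ s'.real = (initState y).real ∧
      s'.query = ⟨[], []⟩ ∧ s'.time ≤ s.time + 1 + 3 * k)
    (fun r => by simp [State.tick, h0, h1, h2, h3, hr, hq]) (by
      rintro k hk r s' ⟨g0, g1, g2, g3, gd, gr, gq, gt⟩
      refine ⟨fun a => { s'.tick.tick.tick with
        nat := Function.update (Function.update s'.nat (10 + k) a) 3 (k + 1) }, ?_, fun a => ?_⟩
      -- The range of the random choice is a computed value occurring in a type, hence the
      -- generalisation to a variable `q` that can be substituted.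
      · have hrand : ∀ q, scale t + scale t - 1 = q →
            (Program.rand (.add (.const 10) (cell 3))
              (.sub (.add (cell 1) (cell 1)) (.const 1))).exec (mixedERM H x) s'.tick
            = (PMF.uniformOfFintype (Fin (q + 1))).map fun a =>
              { s'.tick.tick with nat := Function.update s'.nat (10 + k) a } := by
          intro q hq
          have hq' : (NatExpr.sub (.add (cell 1) (cell 1)) (.const 1)).eval s'.tick = q := by
            simp [NatExpr.eval, cell, State.tick, g1, hq]
          have hk' : (NatExpr.add (.const 10) (cell 3)).eval s'.tick = 10 + k := by
            simp [NatExpr.eval, cell, State.tick, g3]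
          subst hq'
          simp only [Program.exec, hk']
          exact (congrArg _ (PMF.bind_pure_comp Fin.val _)).trans (PMF.map_comp _ _ _)
        rw [drawStep, Program.exec, hrand _ rfl, PMF.bind_map]
        rw [← PMF.bind_pure_comp]
        refine congrArg _ (funext fun a => ?_)
        simp [Function.comp, incr, Program.exec, NatExpr.eval, cell, State.tick, g3,
          update_ten_add_of_lt]
      · simp [State.tick, g0, g1, g2, gr, gq, update_ten_add_of_lt]
        refine ⟨fun j => ?_, by omega⟩
        refine Fin.lastCases ?_ (fun j => ?_) j
        · simp [update_three_ten_add]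
        · have e1 : 10 + (j : ℕ) ≠ 10 + k := by omega
          simp [update_three_ten_add, Function.update_of_ne e1, gd])
  refine ⟨F, hF, fun r => ?_⟩
  obtain ⟨g0, g1, g2, -, gd, gr, gq, gt⟩ := hFi r
  refine ⟨⟨g0, g1, g2, gd, fun i => ?_, gq⟩, gt⟩
  simp [gr, initState]

/-- Signed indices, encoded as numbers below twice the size of the pool. -/
def drawEquiv (M : ℕ) [NeZero M] : Bool × Fin M ≃ Fin (M + M - 1 + 1) :=
  Equiv.ofBijective
    (fun p => ⟨if p.1 then p.2 else M + p.2, by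
      have := p.2.2
      split_ifs <;> omega⟩) <| by
    rw [Fintype.bijective_iff_injective_and_card]
    constructor
    · rintro ⟨b, i⟩ ⟨c, j⟩ h
      have h1 := congrArg Fin.val h
      have := i.2
      have := j.2
      cases b <;> cases c <;> simp at h1 <;> first | omega | simp [Fin.ext_iff, h1]
    · have := NeZero.pos M
      simp
      omega

theorem drawTerm_drawEquiv (x : Fin (t + 1) → X) (h : X → Bool) (p : Bool × Fin (scale t)) :
    drawTerm x h (drawEquiv (scale t) p) = sgn p.1 * val (h (pool x (scale t) p.2)) := by
  obtain ⟨b, i⟩ := p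
  have := i.2
  cases b
  · have h1 : ¬ scale t + (i : ℕ) + 1 ≤ scale t := by omega
    simp [drawTerm, drawEquiv, h1, sgn, pool]
  · have h1 : (i : ℕ) + 1 ≤ scale t := by omega
    simp [drawTerm, drawEquiv, h1, sgn, pool]

theorem answer_drawEquiv (r : Fin (numDraws t) → Bool × Fin (scale t)) (c : ℝ) :
    answer H x y (fun j => drawEquiv (scale t) (r j)) c
      = ⨅ h : H, (perturbedLoss x y r h.1 + |val (h.1 (x (Fin.last t))) - c|) := by
  simp only [answer, drawTerm_drawEquiv]
  rfl

theorem run_ruleProgram (H : Set (X → Bool)) (x : Fin (t + 1) → X) (y : Fin t → I) :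
    ∃ F : (Fin (numDraws t) → Bool × Fin (scale t)) → State t,
      ruleProgram.run H x y = (PMF.uniformOfFintype _).map F ∧
        ∀ r, (F r).real 0 = balance H (perturbedLoss x y r) (x (Fin.last t)) ∧
          (F r).time ≤ 20 * t + 30 := by
  obtain ⟨s, hs, h0, h1, h2, h3, hr, hq, ht⟩ := reaches_prepare (mixedERM H x) y
  obtain ⟨F, hF, hFi⟩ := exec_draw (H := H) (x := x) h0 h1 h2 h3 hr hq
  choose G hG hGr hGt using fun r => reaches_balance (H := H) (x := x) (hFi r).1
  set e := Equiv.arrowCongr (Equiv.refl (Fin (numDraws t))) (drawEquiv (scale t)) with he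
  refine ⟨fun r => G (e r), ?_, fun r => ⟨?_, ?_⟩⟩
  · rw [Program.run, ruleProgram, exec_seq_of_pure hs]
    simp only [Program.exec]
    rw [hF, PMF.bind_map, ← uniform_map_equiv e, PMF.bind_map, ← PMF.bind_pure_comp]
    exact congrArg _ (funext fun r => hG _)
  · rw [hGr, balance, ← answer_drawEquiv, ← answer_drawEquiv]
    rfl
  · have h4 := hGt (e r)
    have h5 := (hFi (e r)).2
    -- The stages add up to at most 18 + 9t + 11n steps for n draws, hence to at most 20t + 29.
    -- Equality n = t + 1 occurs at t = 0.
    have h6 : numDraws t ≤ t + 1 := by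
      unfold numDraws
      rcases Nat.eq_zero_or_pos t with rfl | hpos
      · simp [scale]
      · have := scale_le hpos.ne'
        omega
    simp only at h4 ⊢
    omega

/-- The rule projects to [0,1] and the program does not; for a nonempty class the balance already
lies in [0,1], so the two laws agree. -/
theorem computesInTime_rule (hH : H.Nonempty) :
    ComputesInTime ruleProgram (20 * Polynomial.X + 30) H (rule H) := by
  intro t x y
  obtain ⟨F, hF, hFr⟩ := run_ruleProgram H x y
  constructor
  · intro s hs
    rw [hF, PMF.mem_support_map_iff] at hs
    obtain ⟨r, -, rfl⟩ := hs
    simpa using (hFr r).2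
  · have h1 : (rule H t x y : Measure I) = (predictionPMF H x y).toMeasure := rfl
    rw [h1, PMF.toMeasure_map _ _ measurable_subtype_coe, hF, predictionPMF, PMF.map_comp,
      PMF.map_comp]
    congr 2
    funext r
    simp only [Function.comp, (hFr r).1, prediction]
    exact (congrArg Subtype.val (Set.projIcc_of_mem zero_le_one
      (balance_mem hH (traceFunction_perturbedLoss x y r).finiteOn _))).symm

end Correctness

end

end HybridLearning

namespace HybridLearning

noncomputable section

/-! ### Thresholds -/

theorem thresholds_nonempty : thresholds.Nonempty := ⟨_, 0, rfl⟩

/-- The smallest point labelled 1 serves as the threshold. The last clause is there because even the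
largest threshold a = 1 accepts the point 1, so the zero function is not in the class. -/
theorem mem_traces_thresholds {n : ℕ} (z : Fin n → I) (b : Fin n → Bool) :
    b ∈ traces thresholds z ↔
      (∀ i j, b i = true → b j = false → z j < z i) ∧ ((∀ i, b i = false) → ∀ i, z i < 1) := by
  constructor
  · rintro ⟨_, ⟨a, rfl⟩, hb⟩
    have h1 : ∀ i, b i = true → a ≤ z i := fun i hi => by
      have := hb i; rw [hi] at this; simpa using this
    have h2 : ∀ i, b i = false → z i < a := fun i hi => by
      have := hb i; rw [hi] at this; simpa using this
    exact ⟨fun i j hi hj => (h2 j hj).trans_le (h1 i hi),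
      fun h i => (h2 i (h i)).trans_le a.2.2⟩
  · rintro ⟨h1, h2⟩
    by_cases hall : ∀ i, b i = false
    · refine ⟨_, ⟨1, rfl⟩, fun i => ?_⟩
      rw [hall i]
      simpa using h2 hall i
    · push Not at hall
      obtain ⟨i₀, hi₀⟩ := hall
      obtain ⟨i, hi, hmin⟩ := Finset.exists_min_image (Finset.univ.filter fun i => b i = true) z
        ⟨i₀, by simpa using hi₀⟩
      simp only [Finset.mem_filter, Finset.mem_univ, true_and] at hi hmin
      refine ⟨_, ⟨z i, rfl⟩, fun j => ?_⟩
      cases hj : b j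
      · simpa using h1 i j hi hj
      · simpa using hmin j hj

theorem measurableTraces_thresholds : MeasurableTraces thresholds := by
  refine measurableTraces_of_fin fun n b => ?_
  simp only [mem_traces_thresholds]
  refine MeasurableSet.inter (s₁ := {z : Fin n → I | ∀ i j, b i = true → b j = false → z j < z i})
    (s₂ := {z : Fin n → I | (∀ i, b i = false) → ∀ i, z i < 1}) ?_ ?_
  · simp only [Set.ofPred_forall]
    refine MeasurableSet.iInter fun i => MeasurableSet.iInter fun j => MeasurableSet.iInter fun _ =>
      MeasurableSet.iInter fun _ => measurableSet_lt (measurable_pi_apply j) (measurable_pi_apply i)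
  · simp only [Set.ofPred_forall]
    exact MeasurableSet.iInter fun _ => MeasurableSet.iInter fun i =>
      measurableSet_lt (measurable_pi_apply i) measurable_const

theorem measurableClass_thresholds : MeasurableClass thresholds := fun n y =>
  measurableTraces_thresholds.iInf fun b : Fin n → Bool => ∑ i, |val (b i) - (y i : ℝ)|

/-- A class of monotone functions on a linear order has VC dimension at most one. -/
theorem vcLe_one_of_monotone {X : Type u} [LinearOrder X] {F : Set (X → Bool)}
    (hF : ∀ f ∈ F, ∀ x x', x ≤ x' → f x = true → f x' = true) : VCLe F 1 := by
  intro s hs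
  by_contra! hcard
  obtain ⟨x, hx, x', hx', hne⟩ := Finset.one_lt_card.1 hcard
  wlog hlt : x < x' generalizing x x'
  · exact this x' hx' x hx hne.symm (lt_of_le_of_ne (not_lt.1 hlt) hne.symm)
  obtain ⟨f, hf, hfs⟩ := hs fun w => decide (w = x)
  have h1 := hF f hf x x' hlt.le (by simp [hfs x hx])
  rw [hfs x' hx'] at h1
  exact hlt.ne' (by simpa using h1)

theorem monotone_of_mem_thresholds {h : I → Bool} (hh : h ∈ thresholds) (x x' : I) (hx : x ≤ x')
    (hhx : h x = true) : h x' = true := by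
  obtain ⟨a, rfl⟩ := hh
  simp only [decide_eq_true_eq] at *
  exact hhx.trans hx

theorem vcLe_supClass_thresholds : VCLe (supClass thresholds) 1 := by
  refine vcLe_one_of_monotone ?_
  rintro _ ⟨H', hH', rfl⟩ x x' hx
  simp only [iSup_mem_eq_true]
  rintro ⟨h, hh, hhx⟩
  exact ⟨h, hh, monotone_of_mem_thresholds (hH' hh) x x' hx hhx⟩

theorem vcLe_infClass_thresholds : VCLe (infClass thresholds) 1 := by
  refine vcLe_one_of_monotone ?_
  rintro _ ⟨H', hH', rfl⟩ x x' hx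
  simp only [iInf_mem_eq_true]
  exact fun h f hf => monotone_of_mem_thresholds (hH' hf) x x' hx (h f hf)

/-! ### The theorem -/

/-- On a nonempty domain the suprema and infima of a nonempty class cannot both have VC dimension
zero. -/
theorem one_le_of_vcLe {X : Type u} [Nonempty X] {H : Set (X → Bool)} (hH : H.Nonempty) {d : ℕ}
    (h1 : VCLe (supClass H) d) (h2 : VCLe (infClass H) d) : 1 ≤ d := by
  obtain ⟨h, hh⟩ := hH
  obtain ⟨x⟩ := ‹Nonempty X›
  have key : ∀ F : Set (X → Bool), (∃ f ∈ F, f x = true) → (∃ f ∈ F, f x = false) →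
      VCLe F d → 1 ≤ d := by
    rintro F ⟨f, hf, hfx⟩ ⟨g, hg, hgx⟩ hF
    have := hF {x} fun b => by
      cases hb : b x
      · exact ⟨g, hg, by simp [hb, hgx]⟩
      · exact ⟨f, hf, by simp [hb, hfx]⟩
    simpa using this
  cases hx : h x
  · exact key (infClass H) ⟨_, ⟨∅, Set.empty_subset _, rfl⟩, by simp⟩
      ⟨_, ⟨{h}, by simpa using hh, rfl⟩, by simp [hx]⟩ h2
  · exact key (supClass H) ⟨_, ⟨{h}, by simpa using hh, rfl⟩, by simp [hx]⟩
      ⟨_, ⟨∅, Set.empty_subset _, rfl⟩, by simp⟩ h1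

end

end HybridLearning

open HybridLearning in
theorem theorem3p10 :
    ∃ (C : ℝ) (P : Program) (τ : Polynomial ℕ),
      (∀ (X : Type u) [MeasurableSpace X] (H : Set (X → Bool)),
        H.Nonempty → MeasurableClass H →
          ∃ Φ : PredictionRule X, ComputesInTime P τ H Φ ∧
            ∀ d : ℕ, max (vcDim (supClass H)) (vcDim (infClass H)) = d →
              ∀ T : ℕ, regret H Φ T ≤ C * √(d * T)) ∧
      (∃ Φ : PredictionRule I, ComputesInTime P τ thresholds Φ ∧
        ∀ T : ℕ, regret thresholds Φ T ≤ C * √T) := by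
  refine ⟨430, ruleProgram, 20 * Polynomial.X + 30, fun X _ H hH hm => ?_, ?_⟩
  · refine ⟨rule H, computesInTime_rule hH, fun d hd T => ?_⟩
    have h1 : VCLe (supClass H) d := .of_vcDim_le ((le_max_left _ _).trans hd.le)
    have h2 : VCLe (infClass H) d := .of_vcDim_le ((le_max_right _ _).trans hd.le)
    -- On an empty domain d may be 0, but there is no probability measure and the regret is a
    -- supremum over the empty family, that is 0.
    rcases isEmpty_or_nonempty X with hX | hX
    · refine Real.iSup_le (fun μ => ?_) (by positivity)
      exact (μ.nonempty.elim hX.elim)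
    · exact regret_rule_le hH hm (one_le_of_vcLe hH h1 h2) h1 h2 T
  · refine ⟨rule thresholds, computesInTime_rule thresholds_nonempty, fun T => ?_⟩
    simpa using regret_rule_le thresholds_nonempty measurableClass_thresholds le_rfl
      vcLe_supClass_thresholds vcLe_infClass_thresholds T
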